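/- \textbf{Theorem (Tameness and type shortness down for $\Pi^1_1$).} Let $\kappa$ be a $\Pi^1_1$-indescribable (that is, weakly compact) cardinal: for every $U\subseteq V_\kappa$ and every $\Pi^1_1$ sentence $\varphi$ in the language $\{\in,U\}$ (a block of universal quantifiers over subsets of the domain, followed by a first-order formula), if $\langle V_\kappa,\in,U\rangle\models\varphi$ then there is $\alpha<\kappa$ with $\langle V_\alpha,\in,U\cap V_\alpha\rangle\models\varphi$. Let $(K,\prec)$ be an abstract elementary class with Löwenheim--Skolem number $LS(K)<\kappa$ that has no models of size smaller than $LS(K)$, and suppose that $K$ has the $\kappa$-amalgamation property: whenever $M\prec N_0$ and $M\prec N_1$ with $M,N_0,N_1\in K$ all of size $\kappa$, there are $N^*\in K$ and $K$-embeddings $f_i:N_i\to N^*$ with $f_0\restriction M=f_1\restriction M$. For $M\in K$ and an index set $I$, let $S^I(M)$ be the set of Galois types over $M$ of sequences indexed by $I$: classes $tp(\langle a_i\rangle_{i\in I}/M,N)$ of triples $(\langle a_i\rangle_{i\in I},M,N)$ with $M\prec N\in K$, $\|N\|=\|M\|+|I|$ and all $a_i\in N$, modulo the transitive closure of the relation that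 holds between $(\langle a_i\rangle,M,N)$ and $(\langle b_i\rangle,M,N')$ iff there are $N^*\in K$ and $K$-embeddings $f:N\to N^*$, $g:N'\to N^*$ with $f\restriction M=g\restriction M$ and $f(a_i)=g(b_i)$ for all $i\in I$. For $p=tp(\langle a_i\rangle_{i\in I}/M,N)$, $M_0\prec M$ and $I'\subseteq I$, the restriction $p\restriction M_0\in S^I(M_0)$ is $tp(\langle a_i\rangle_{i\in I}/M_0,N_0)$ for any $N_0$ with $M_0\prec N_0\prec N$ that contains all $a_i$ and has size $\|M_0\|+|I|$, and $p^{I'}\in S^{I'}(M)$ is the type over $M$ of $\langle a_i\rangle_{i\in I'}$ (computed, likewise, in any $N_0$ with $M\prec N_0\prec N$ that contains these $a_i$ and has size $\|M\|+|I'|$). Then: (1) $K$ is $(<\kappa,\kappa)$ tame for types of length $<\kappa$: for every $I$ with $|I|<\kappa$, every $M\in K$ of size $\kappa$ and all $p\neq q$ in $S^I(M)$, there is $N\prec M$ with $\|N\|<\kappa$ and $p\restriction N\neq q\restriction N$. (2) $K$ is $(<\kappa,\kappa)$ type short over models of size $<\kappa$: for every $M\in K$ of size $<\kappa$, every $I$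 with $|I|=\kappa$ and all $p\neq q$ in $S^I(M)$, there is $I'\subseteq I$ with $|I'|<\kappa$ and $p^{I'}\neq q^{I'}$. -/

import Mathlib

open FirstOrder Cardinal
open scoped ZFSet

universe u

/-! ### Indescribable cardinals -/

/-- Relation symbols: `∈`, a unary predicate `U`, and `k` unary predicate variables `X 0, …, X (k-1)`
(the type-2 variables, which range over subsets of the domain). -/
inductive SetRelSymb (k : ℕ) : ℕ → Type
  | mem : SetRelSymb k 2
  | U : SetRelSymb k 1
  | X (i : Fin k) : SetRelSymb k 1

/-- The relational language `{∈, U, X 0, …, X (k-1)}`. -/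
def setLang (k : ℕ) : FirstOrder.Language.{0, 0} := ⟨fun _ => Empty, SetRelSymb k⟩

/-- The structure `⟨A, ∈, U ∩ A, X 0 ∩ A, …⟩` on the elements of the set `A`. -/
@[reducible]
def setStructure (A U : ZFSet.{u}) {k : ℕ} (X : Fin k → ZFSet.{u}) :
    (setLang k).Structure {x : ZFSet.{u} // x ∈ A} where
  funMap := fun f => nomatch f
  RelMap := fun r v => match r with
    | SetRelSymb.mem => (v 0).1 ∈ (v 1).1
    | SetRelSymb.U => (v 0).1 ∈ U
    | SetRelSymb.X i => (v 0).1 ∈ X i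

/-- `⟨A, ∈, U⟩` satisfies the `Π¹₁` sentence `∀ X₀ … ∀ X_{k-1}, φ`, where the `Xᵢ` range over all
subsets of `A` and `φ` is a first-order sentence in the language `{∈, U, X₀, …, X_{k-1}}`. -/
def SatisfiesPi11 (A U : ZFSet.{u}) (k : ℕ) (φ : (setLang k).Sentence) : Prop :=
  ∀ X : Fin k → ZFSet.{u}, (∀ i, X i ⊆ A) →
    letI := setStructure A U X
    {x : ZFSet.{u} // x ∈ A} ⊨ φ

/-- `κ` is `Π¹₁`-indescribable: every `Π¹₁` sentence true in `⟨V_κ, ∈, U⟩`, with `U ⊆ V_κ`, is true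
in `⟨V_α, ∈, U ∩ V_α⟩` for some `α < κ`. -/
def IsPi11Indescribable (κ : Cardinal.{u}) : Prop :=
  ∀ U : ZFSet.{u}, U ⊆ V_ κ.ord → ∀ (k : ℕ) (φ : (setLang k).Sentence),
    SatisfiesPi11 (V_ κ.ord) U k φ →
      ∃ α < κ.ord, SatisfiesPi11 (V_ α) (U ∩ V_ α) k φ

/-! ### Abstract elementary classes -/

/-- For a class `Mem` of `L`-structures and a relation `Strong` on it (`Strong S` says `S ≺ N`, for
a substructure `S` of `N`): `⟨S i : i < α⟩` is a `≺`-increasing continuous chain of members of the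
class, all of them substructures of the `L`-structure `A`, which need not be in the class. -/
def IsStrongChain {L : FirstOrder.Language.{u, u}} (Mem : ∀ (M : Type u) [L.Structure M], Prop)
    (Strong : ∀ {N : Type u} [L.Structure N], L.Substructure N → Prop)
    {A : Type u} [L.Structure A] (α : Ordinal.{u}) (S : Ordinal.{u} → L.Substructure A) : Prop :=
  (∀ i < α, Mem (S i)) ∧
  (∀ i j, i ≤ j → j < α → S i ≤ S j ∧ Strong ((S i).comap (S j).subtype.toHom)) ∧
  (∀ δ < α, Order.IsSuccLimit δ → (S δ : Set A) = ⋃ i ∈ Set.Iio δ, (S i : Set A))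

/-- The Löwenheim–Skolem property for the cardinal `lam`. -/
def HasLSProperty {L : FirstOrder.Language.{u, u}} (Mem : ∀ (M : Type u) [L.Structure M], Prop)
    (Strong : ∀ {N : Type u} [L.Structure N], L.Substructure N → Prop)
    (lam : Cardinal.{u}) : Prop :=
  L.card + ℵ₀ ≤ lam ∧ ∀ (M : Type u) [L.Structure M], Mem M → ∀ A : Set M,
    ∃ N : L.Substructure M, Strong N ∧ A ⊆ N ∧ #N ≤ #A + lam

/-- An abstract elementary class of `L`-structures. `Mem M` says `M ∈ K`, and for a substructure `S`
of `N`, `Strong S` says `S ≺_K N`. (Antisymmetry of `≺_K` follows from `≺_K` refining `⊆`, which is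
built into the type of `Strong`.) -/
structure AEC (L : FirstOrder.Language.{u, u}) where
  Mem : ∀ (M : Type u) [L.Structure M], Prop
  Strong : ∀ {N : Type u} [L.Structure N], L.Substructure N → Prop
  mem_of_strong : ∀ {N : Type u} [L.Structure N] {S : L.Substructure N},
    Strong S → Mem S ∧ Mem N
  strong_refl : ∀ (N : Type u) [L.Structure N], Mem N → Strong (⊤ : L.Substructure N)
  strong_trans : ∀ {N : Type u} [L.Structure N] {S : L.Substructure N} {T : L.Substructure S},
    Strong T → Strong S → Strong (T.map S.subtype.toHom)
  mem_iso : ∀ {N N' : Type u} [L.Structure N] [L.Structure N'], (N ≃[L] N') → Mem N → Mem N'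
  strong_iso : ∀ {N N' : Type u} [L.Structure N] [L.Structure N'] (f : N ≃[L] N')
    {S : L.Substructure N}, Strong S → Strong (S.map f.toHom)
  coherence : ∀ {N : Type u} [L.Structure N] {S T : L.Substructure N},
    Strong S → Strong T → S ≤ T → Strong (S.comap T.subtype.toHom)
  /-- The union `A` of a nonempty `≺`-increasing continuous chain is in `K`, and each member of the
  chain is `≺ A`. -/
  union_mem : ∀ {A : Type u} [L.Structure A] (α : Ordinal.{u}) (S : Ordinal.{u} → L.Substructure A),
    0 < α → IsStrongChain Mem Strong α S → (⋃ i ∈ Set.Iio α, (S i : Set A)) = Set.univ →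
      Mem A ∧ ∀ i < α, Strong (S i)
  /-- If all members of such a chain are `≺ N`, then so is its union `T`. -/
  union_strong : ∀ {N : Type u} [L.Structure N] (α : Ordinal.{u})
    (S : Ordinal.{u} → L.Substructure N) (T : L.Substructure N),
    0 < α → IsStrongChain Mem Strong α S → (∀ i < α, Strong (S i)) →
      (T : Set N) = (⋃ i ∈ Set.Iio α, (S i : Set N)) → Strong T
  exists_LS : ∃ lam : Cardinal.{u}, HasLSProperty Mem Strong lam

namespace AEC

variable {L : FirstOrder.Language.{u, u}} (K : AEC L)

/-- The Löwenheim–Skolem number. -/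
noncomputable def LS : Cardinal.{u} := sInf {lam | HasLSProperty K.Mem K.Strong lam}

theorem hasLSProperty_LS : HasLSProperty K.Mem K.Strong K.LS := csInf_mem K.exists_LS

/-- `K` has no models of size smaller than its Löwenheim–Skolem number. -/
class NoSmallModels : Prop where
  LS_le : ∀ (M : Type u) [L.Structure M], K.Mem M → K.LS ≤ #M

/-- `f : M → N` is a `K`-embedding: `f(M) ≺_K N`. -/
def IsKEmb {M N : Type u} [L.Structure M] [L.Structure N] (f : M ↪[L] N) : Prop :=
  K.Strong f.toHom.range

/-- The `lam`-amalgamation property. -/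
def Amalgamation (lam : Cardinal.{u}) : Prop :=
  ∀ (M N₀ N₁ : Type u) [L.Structure M] [L.Structure N₀] [L.Structure N₁],
    #M = lam → #N₀ = lam → #N₁ = lam →
    ∀ (g₀ : M ↪[L] N₀) (g₁ : M ↪[L] N₁), K.IsKEmb g₀ → K.IsKEmb g₁ →
      ∃ (N : Type u) (_ : L.Structure N) (f₀ : N₀ ↪[L] N) (f₁ : N₁ ↪[L] N),
        K.IsKEmb f₀ ∧ K.IsKEmb f₁ ∧ ∀ m, f₀ (g₀ m) = f₁ (g₁ m)

section KEmb

variable {K} {M N P : Type u} [L.Structure M] [L.Structure N] [L.Structure P]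

theorem IsKEmb.mem_right {f : M ↪[L] N} (hf : K.IsKEmb f) : K.Mem N := (K.mem_of_strong hf).2

theorem IsKEmb.mem_left {f : M ↪[L] N} (hf : K.IsKEmb f) : K.Mem M :=
  K.mem_iso f.equivRange.symm (K.mem_of_strong hf).1

theorem IsKEmb.refl (hM : K.Mem M) : K.IsKEmb (FirstOrder.Language.Embedding.refl L M) := by
  have h := K.strong_refl M hM
  have e : (FirstOrder.Language.Embedding.refl L M).toHom.range = ⊤ := by
    ext x; simp
  unfold IsKEmb; rwa [e]

theorem isKEmb_subtype {S : L.Substructure N} (hS : K.Strong S) : K.IsKEmb S.subtype := by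
  unfold IsKEmb; rwa [FirstOrder.Language.Substructure.range_subtype]

theorem IsKEmb.comp {g : N ↪[L] P} {f : M ↪[L] N} (hg : K.IsKEmb g) (hf : K.IsKEmb f) :
    K.IsKEmb (g.comp f) := by
  have h := K.strong_trans (K.strong_iso g.equivRange hf) hg
  have e : (g.comp f).toHom.range =
      (f.toHom.range.map g.equivRange.toHom).map g.toHom.range.subtype.toHom := by
    ext x
    simp [FirstOrder.Language.Substructure.mem_map]
  unfold IsKEmb; rwa [e]

/-- Corestriction of a `K`-embedding is a `K`-embedding, by coherence. -/
theorem IsKEmb.codRestrict {f : M ↪[L] N} (hf : K.IsKEmb f) {S : L.Substructure N}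
    (hS : K.Strong S) (h : ∀ m, f m ∈ S) : K.IsKEmb (f.codRestrict S h) := by
  have hle : f.toHom.range ≤ S := by
    rintro _ ⟨m, rfl⟩; exact h m
  have hc := K.coherence hf hS hle
  have e : (f.codRestrict S h).toHom.range = f.toHom.range.comap S.subtype.toHom := by
    ext x
    simp [FirstOrder.Language.Substructure.mem_comap, Subtype.ext_iff]
  unfold IsKEmb; rwa [e]

end KEmb

/-! ### Galois types -/

/-- A pretype `(⟨a i : i ∈ I⟩, M, N)` over `M`, with `N ∈ K` of size `‖M‖ + |I|`. As everything is
taken up to isomorphism over `M`, `M ≺ N` is given by a `K`-embedding of `M` in `N`. -/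
structure Pretype (I M : Type u) [L.Structure M] where
  N : Type u
  [str : L.Structure N]
  emb : M ↪[L] N
  isKEmb : K.IsKEmb emb
  card_eq : #N = #M + #I
  a : I → N

attribute [instance] Pretype.str

variable {K}

namespace Pretype

variable {I J M M' : Type u} [L.Structure M] [L.Structure M']

/-- The relation `∼_AT` of atomic equivalence: the two pretypes have an amalgam over `M` in which
the two sequences are identified. -/
def AT (p q : K.Pretype I M) : Prop :=
  ∃ (N : Type u) (_ : L.Structure N) (f : p.N ↪[L] N) (g : q.N ↪[L] N),
    K.IsKEmb f ∧ K.IsKEmb g ∧ (∀ m, f (p.emb m) = g (q.emb m)) ∧ ∀ i, f (p.a i) = g (q.a i)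

theorem AT.refl (p : K.Pretype I M) : p.AT p :=
  ⟨p.N, p.str, .refl L _, .refl L _, .refl p.isKEmb.mem_right, .refl p.isKEmb.mem_right,
    fun _ => rfl, fun _ => rfl⟩

theorem AT.symm {p q : K.Pretype I M} : p.AT q → q.AT p :=
  fun ⟨N, s, f, g, hf, hg, hm, ha⟩ => ⟨N, s, g, f, hg, hf, fun m => (hm m).symm,
    fun i => (ha i).symm⟩

/-- The relation `∼`, the transitive closure of `∼_AT`. -/
instance setoid (K : AEC L) (I M : Type u) [L.Structure M] : Setoid (K.Pretype I M) where
  r := Relation.TransGen AT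
  iseqv := ⟨fun p => .single (AT.refl p),
    fun h => by
      induction h with
      | single h => exact .single h.symm
      | tail _ h ih => exact .head h.symm ih,
    fun h k => h.trans k⟩

/-- Given a `K`-embedding `e : M' → M` (say the inclusion of `M' ≺ M`) and an injection `s : J → I`
(say the inclusion of `J ⊆ I`), the pretype `r` is `(⟨a i : i ∈ J⟩, M', N')` for some `N'` with
`M' ≺ N' ≺ N`, where `p = (⟨a i : i ∈ I⟩, M, N)`. -/
def IsRestriction (e : M' ↪[L] M) (s : J ↪ I) (p : K.Pretype I M) (r : K.Pretype J M') : Prop :=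
  ∃ j : r.N ↪[L] p.N, K.IsKEmb j ∧ (∀ m, j (r.emb m) = p.emb (e m)) ∧ ∀ i, j (r.a i) = p.a (s i)

theorem exists_isRestriction [K.NoSmallModels] {e : M' ↪[L] M} (he : K.IsKEmb e) (s : J ↪ I)
    (p : K.Pretype I M) : ∃ r, IsRestriction e s p r := by
  classical
  have hLS := K.hasLSProperty_LS
  have hM' : K.LS ≤ #M' := NoSmallModels.LS_le M' he.mem_left
  have hinf : ℵ₀ ≤ #M' + #J :=
    (le_add_self.trans hLS.1).trans (hM'.trans le_self_add)
  have hle : #(M' ⊕ J) ≤ #p.N := by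
    rw [mk_sum, lift_id, lift_id, p.card_eq]
    exact add_le_add (mk_le_of_injective e.injective) (mk_le_of_injective s.injective)
  obtain ⟨g⟩ := Cardinal.le_def _ _ |>.1 hle
  let F : (M' ⊕ J) ⊕ (M' ⊕ J) → p.N :=
    Sum.elim g (Sum.elim (fun m => p.emb (e m)) (fun i => p.a (s i)))
  obtain ⟨N', hN', hA, hcard⟩ := hLS.2 p.N p.isKEmb.mem_right (Set.range F)
  have hr : #(Set.range F) ≤ #M' + #J := by
    refine mk_range_le.trans ?_
    simp only [mk_sum, lift_id]
    rw [add_eq_self hinf]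
  have h1 : ∀ m, (p.emb.comp e) m ∈ N' := fun m => hA ⟨Sum.inr (Sum.inl m), rfl⟩
  have h2 : ∀ i, p.a (s i) ∈ N' := fun i => hA ⟨Sum.inr (Sum.inr i), rfl⟩
  have h3 : ∀ x, g x ∈ N' := fun x => hA ⟨Sum.inl x, rfl⟩
  refine ⟨{ N := N'
            emb := (p.emb.comp e).codRestrict N' h1
            isKEmb := (p.isKEmb.comp he).codRestrict hN' h1
            card_eq := le_antisymm ?_ ?_
            a := fun i => ⟨p.a (s i), h2 i⟩ }, N'.subtype, isKEmb_subtype hN', ?_, ?_⟩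
  · have hL : K.LS ≤ #M' + #J := hM'.trans le_self_add
    exact hcard.trans ((add_le_add hr hL).trans (add_eq_self hinf).le)
  · have : #(M' ⊕ J) ≤ #N' :=
      mk_le_of_injective (f := fun x => (⟨g x, h3 x⟩ : N'))
        (fun x y h => g.injective (congrArg Subtype.val h))
    simpa only [mk_sum, lift_id] using this
  · intro m; rfl
  · intro i; rfl

theorem AT.isRestriction {e : M' ↪[L] M} {s : J ↪ I} {p q : K.Pretype I M} {r t : K.Pretype J M'}
    (h : p.AT q) (hr : IsRestriction e s p r) (ht : IsRestriction e s q t) : r.AT t := by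
  obtain ⟨N, _, f, g, hf, hg, hm, ha⟩ := h
  obtain ⟨j, hj, hjm, hja⟩ := hr
  obtain ⟨k, hk, hkm, hka⟩ := ht
  refine ⟨N, _, f.comp j, g.comp k, hf.comp hj, hg.comp hk, fun m => ?_, fun i => ?_⟩
  · simp [hjm, hkm, hm]
  · simp [hja, hka, ha]

theorem equiv_of_isRestriction [K.NoSmallModels] {e : M' ↪[L] M} (he : K.IsKEmb e) {s : J ↪ I}
    {p q : K.Pretype I M} (h : p ≈ q) {r t : K.Pretype J M'}
    (hr : IsRestriction e s p r) (ht : IsRestriction e s q t) : r ≈ t := by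
  change Relation.TransGen AT p q at h
  change Relation.TransGen AT r t
  induction h generalizing t with
  | single h => exact .single (h.isRestriction hr ht)
  | tail _ h ih =>
    obtain ⟨r', hr'⟩ := exists_isRestriction he s _
    exact (ih hr').tail (h.isRestriction hr' ht)

end Pretype

/-- `S^I(M)`: the Galois types over `M` of sequences indexed by `I`. -/
def GaloisType (K : AEC L) (I M : Type u) [L.Structure M] : Type (u + 1) :=
  Quotient (Pretype.setoid K I M)

namespace GaloisType

variable [K.NoSmallModels] {I J M M' : Type u} [L.Structure M] [L.Structure M']

/-- The restriction of `tp(⟨a i : i ∈ I⟩/M, N)` along a `K`-embedding `e : M' → M` and an injection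
`s : J → I`: it is `tp(⟨a i : i ∈ J⟩/M', N')` for any `N'` of size `‖M'‖ + |J|` with `M' ≺ N' ≺ N`
that contains the `a i`, `i ∈ J`. -/
noncomputable def reduct (e : M' ↪[L] M) (he : K.IsKEmb e) (s : J ↪ I) :
    K.GaloisType I M → K.GaloisType J M' :=
  Quotient.map (fun p => (Pretype.exists_isRestriction he s p).choose)
    fun p q h => Pretype.equiv_of_isRestriction he h
      (Pretype.exists_isRestriction he s p).choose_spec
      (Pretype.exists_isRestriction he s q).choose_spec

/-- The restriction `p ↾ M₀` of a type over `M` to `M₀ ≺ M`. -/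
noncomputable def restrict (p : K.GaloisType I M) {M₀ : L.Substructure M} (h : K.Strong M₀) :
    K.GaloisType I M₀ :=
  p.reduct M₀.subtype (isKEmb_subtype h) (Function.Embedding.refl I)

/-- The restriction `p^{I'}` of a type of length `I` over `M ∈ K` to `I' ⊆ I`. -/
noncomputable def subtuple (p : K.GaloisType I M) (hM : K.Mem M) (I' : Set I) :
    K.GaloisType I' M :=
  p.reduct (FirstOrder.Language.Embedding.refl L M) (.refl hM) (Function.Embedding.subtype (· ∈ I'))

end GaloisType

/-! ### Tameness and type shortness -/

variable (K) [K.NoSmallModels]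

/-- `K` is `(<κ, lam)` tame for `I` length types. -/
def IsTameLT (κ lam : Cardinal.{u}) (I : Type u) : Prop :=
  ∀ (M : Type u) [L.Structure M], K.Mem M → #M = lam → ∀ p q : K.GaloisType I M, p ≠ q →
    ∃ (N : L.Substructure M) (hN : K.Strong N), #N < κ ∧ p.restrict hN ≠ q.restrict hN

/-- `K` is `(<κ, lam)` type short over `μ` sized models. -/
def IsTypeShortLT (κ lam μ : Cardinal.{u}) : Prop :=
  ∀ (M : Type u) [L.Structure M] (hM : K.Mem M), #M = μ → ∀ I : Type u, #I = lam →
    ∀ p q : K.GaloisType I M, p ≠ q →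
      ∃ I' : Set I, #I' < κ ∧ p.subtuple hM I' ≠ q.subtuple hM I'

end AEC

/-! Indescribability enters only through a branch property: for every `κ`-sequence of subsets of
`V_κ` there is a set `X` whose trace on each `V_β` is the trace of some member of index at least
`β`. Otherwise every `X ⊆ V_κ` has, for some `β`, a trace on `V_β` shared by no member of index at
least `β`. With the set of these bad traces as the predicate `U`, this is a `Π¹₁` statement; it
reflects to some `V_α`, where the `α`-th member of the sequence refutes it. The branch property
makes `κ` regular and strong limit, and gives `exists_coherent_choice`: if every stage `i` has, at
each level `j`, one of fewer than `κ` kinds, then stages `σ j ≥ j` can be chosen so that later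
choices keep the kinds at earlier levels.

Both conclusions are instances of `GaloisType.eq_of_reduct_eq`. When `#M + #I = κ`, exhaust `M` and
`I` by a `κ`-chain of pairs `(E j, J j)` of total size below `κ`; types that agree on all these
pairs are equal. For tameness `E j` grows and `J j` is all of `I`; for type shortness `E j` is `M`
and `J j` grows.

Agreement at level `i` is witnessed by a finite zigzag of amalgams. Name the elements of all these
structures by one fixed set of labels, filtered into levels of size below `κ`. The kind of a zigzag
at level `j` consists of its length and the formulas true of the labels of level `j`, so there are
fewer than `κ` kinds. Along a coherent choice of zigzags the labelled parts form directed systems of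
`K`-embeddings. Their direct limits form a single zigzag over `M`, of the same finite length,
leading from `p` to `q` (`exists_limit_zigzag`, `equiv_of_isZigzagAt`). -/

/-! ### Reflection of a `Π¹₁` sentence gives branches -/

open FirstOrder.Language in
/-- `∃ c, U c ∧ ∃ x ∈ c, (∀ z ∈ c, z = x ∨ z ∈ x) ∧ ∀ z ∈ x, (z ∈ c ↔ X z)`. -/
def badTraceSentence : (setLang 1).Sentence :=
  let memR : (setLang 1).Relations 2 := SetRelSymb.mem
  let UR : (setLang 1).Relations 1 := SetRelSymb.U
  let XR : (setLang 1).Relations 1 := SetRelSymb.X 0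
  ∃' (UR.boundedFormula₁ (&0) ⊓ ∃' (memR.boundedFormula₂ (&1) (&0) ⊓
    (∀' (memR.boundedFormula₂ (&2) (&0) ⟹ ((&2 =' &1) ⊔ memR.boundedFormula₂ (&2) (&1)))) ⊓
    (∀' (memR.boundedFormula₂ (&2) (&1) ⟹
      (memR.boundedFormula₂ (&2) (&0)).iff (XR.boundedFormula₁ (&2))))))

theorem satisfiesPi11_badTraceSentence {A U : ZFSet.{u}} :
    SatisfiesPi11 A U 1 badTraceSentence ↔ ∀ X ⊆ A, ∃ c ∈ A, c ∈ U ∧ ∃ x ∈ A, x ∈ c ∧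
      (∀ z ∈ A, z ∈ c → z = x ∨ z ∈ x) ∧ ∀ z ∈ A, z ∈ x → (z ∈ c ↔ z ∈ X) := by
  have key : ∀ X : Fin 1 → ZFSet.{u},
      (letI := setStructure A U X; {x : ZFSet.{u} // x ∈ A} ⊨ badTraceSentence) ↔
      ∃ c ∈ A, c ∈ U ∧ ∃ x ∈ A, x ∈ c ∧
      (∀ z ∈ A, z ∈ c → z = x ∨ z ∈ x) ∧ ∀ z ∈ A, z ∈ x → (z ∈ c ↔ z ∈ X 0) := by
    intro X
    let := setStructure A U X
    simp only [badTraceSentence, FirstOrder.Language.Sentence.Realize,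
      FirstOrder.Language.Formula.Realize, FirstOrder.Language.BoundedFormula.realize_ex,
      FirstOrder.Language.BoundedFormula.realize_all, FirstOrder.Language.BoundedFormula.realize_inf,
      FirstOrder.Language.BoundedFormula.realize_imp, FirstOrder.Language.BoundedFormula.realize_iff,
      FirstOrder.Language.BoundedFormula.realize_sup,
      FirstOrder.Language.BoundedFormula.realize_bdEqual, Subtype.exists, Subtype.forall, and_assoc]
    constructor
    · rintro ⟨c, hc, hU, x, hx, h1, h2, h3⟩
      exact ⟨c, hc, hU, x, hx, h1, fun z hz hzc => (h2 z hz hzc).imp_left (congrArg Subtype.val), h3⟩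
    · rintro ⟨c, hc, hU, x, hx, h1, h2, h3⟩
      exact ⟨c, hc, hU, x, hx, h1, fun z hz hzc => (h2 z hz hzc).imp_left Subtype.ext, h3⟩
  constructor
  · intro h X hX
    exact (key fun _ => X).1 (h (fun _ => X) fun _ => hX)
  · intro h X hX
    exact (key X).2 (h (X 0) (hX 0))

/-- A `Π¹₁`-indescribable limit `κ` has the branch property: a `κ`-sequence of subsets of `V_κ` has
a limit point, in the topology whose basic open sets are given by traces on the `V_β`. -/
theorem IsPi11Indescribable.exists_branch {κ : Cardinal.{u}} (hκ : IsPi11Indescribable κ)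
    (hinf : ℵ₀ ≤ κ) (Xs : Ordinal.{u} → ZFSet.{u}) :
    ∃ X : ZFSet.{u}, ∀ β < κ.ord, ∃ i < κ.ord, β ≤ i ∧ ∀ z ∈ V_ β, z ∈ X ↔ z ∈ Xs i := by
  by_contra! hcon
  -- The pair `(β, s)` is coded by the one set `s ∪ {V_β}`: as `s ⊆ V_β`, the element `V_β` is
  -- recovered as the `∈`-greatest one, which is how the sentence decodes it.
  let Bad : ZFSet.{u} → Prop := fun c => ∃ β < κ.ord, ∃ s ⊆ V_ β, c = insert (V_ β) s ∧
    ∀ i < κ.ord, β ≤ i → ∃ z ∈ V_ β, ¬ (z ∈ s ↔ z ∈ Xs i)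
  have hlim := isSuccLimit_ord hinf
  obtain ⟨α, hα, h⟩ := hκ (ZFSet.sep Bad (V_ κ.ord)) (fun x hx => (ZFSet.mem_sep.1 hx).1) 1
    badTraceSentence (by
      rw [satisfiesPi11_badTraceSentence]
      intro X hX
      obtain ⟨β, hβ, hb⟩ := hcon X
      have hc : insert (V_ β) (ZFSet.sep (· ∈ X) (V_ β)) ∈ V_ κ.ord := by
        rw [ZFSet.mem_vonNeumann']
        refine ⟨Order.succ β, hlim.succ_lt hβ, fun x hx => ?_⟩
        rcases ZFSet.mem_insert_iff.1 hx with rfl | hx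
        · exact ZFSet.vonNeumann_mem_of_lt (Order.lt_succ β)
        · exact ZFSet.vonNeumann_subset_of_le (Order.le_succ β) (ZFSet.mem_sep.1 hx).1
      refine ⟨_, hc, ZFSet.mem_sep.2 ⟨hc, β, hβ, _, fun x hx => (ZFSet.mem_sep.1 hx).1, rfl, ?_⟩,
        V_ β, ZFSet.vonNeumann_mem_of_lt hβ, ZFSet.mem_insert_iff.2 (.inl rfl), ?_, ?_⟩
      · intro i hi hβi
        obtain ⟨z, hz, hzz⟩ := hb i hi hβi
        refine ⟨z, hz, ?_⟩
        rw [ZFSet.mem_sep]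
        tauto
      · intro z _ hz
        exact (ZFSet.mem_insert_iff.1 hz).imp_right fun h => (ZFSet.mem_sep.1 h).1
      · intro z _ hz
        rw [ZFSet.mem_insert_iff, ZFSet.mem_sep]
        have : z ≠ V_ β := fun h => ZFSet.mem_irrefl _ (h ▸ hz)
        tauto)
  rw [satisfiesPi11_badTraceSentence] at h
  -- The diagonal choice: the trace of `Xs α` itself has a bad trace at some `β < α`, yet stage `α ≥
  -- β` realizes that trace.
  obtain ⟨c, hcα, hcU, x, hx, hxc, hx1, hx2⟩ := h (ZFSet.sep (· ∈ Xs α) (V_ α))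
    (fun x hx => (ZFSet.mem_sep.1 hx).1)
  obtain ⟨β, hβ, s, hs, rfl, hbad⟩ := (ZFSet.mem_sep.1 (ZFSet.mem_inter.1 hcU).1).2
  have hVβ : V_ β ∈ V_ α := (ZFSet.isTransitive_vonNeumann α).mem_trans
    (ZFSet.mem_insert_iff.2 (.inl rfl)) hcα
  have hxβ : x = V_ β := by
    rcases ZFSet.mem_insert_iff.1 hxc with h | h
    · exact h
    · rcases hx1 _ hVβ (ZFSet.mem_insert_iff.2 (.inl rfl)) with h' | h'
      · exact h'.symm
      · exact absurd (hs h) (ZFSet.mem_asymm h')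
  subst hxβ
  have hβα : β < α := ZFSet.vonNeumann_mem_vonNeumann_iff.1 hVβ
  obtain ⟨z, hz, hzz⟩ := hbad α hα hβα.le
  refine hzz ?_
  have hzα := ZFSet.vonNeumann_subset_of_le hβα.le hz
  have := hx2 z hzα hz
  rw [ZFSet.mem_insert_iff, ZFSet.mem_sep] at this
  have : z ≠ V_ β := fun h => ZFSet.mem_irrefl _ (h ▸ hz)
  tauto

/-! ### Consequences of the branch property: regularity, strong limit, coherent choices -/

/-- A well-order `T` whose order type is an infinite initial ordinal has the branch property: every
`T`-sequence of subsets of `T` has a limit point in the topology of traces on initial segments. -/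
structure HasBranchProperty (T : Type u) [LinearOrder T] [WellFoundedLT T] : Prop where
  ord_mk : ord #T = Ordinal.type (α := T) (· < ·)
  aleph0_le : ℵ₀ ≤ #T
  exists_branch : ∀ F : T → Set T, ∃ X : Set T, ∀ b, ∃ i, b ≤ i ∧ ∀ t < b, t ∈ X ↔ t ∈ F i

theorem IsPi11Indescribable.hasBranchProperty {κ : Cardinal.{u}} (hκ : IsPi11Indescribable κ)
    (hinf : ℵ₀ ≤ κ) : HasBranchProperty κ.ord.ToType where
  ord_mk := by simp
  aleph0_le := by simpa
  exists_branch F := by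
    -- A von Neumann ordinal has itself as rank, so the codes of all `t < b` lie in the
    -- corresponding level `V_b`.
    let c : κ.ord.ToType → ZFSet.{u} := fun t => (Ordinal.ToType.mk.symm t).1.toZFSet
    have hc : Function.Injective c := fun a b h =>
      Ordinal.ToType.mk.symm.injective (Subtype.ext (Ordinal.toZFSet_injective h))
    obtain ⟨X, hX⟩ := hκ.exists_branch hinf fun o =>
      if h : o < κ.ord then ZFSet.range fun t : F (Ordinal.ToType.mk ⟨o, h⟩) => c t else ∅
    refine ⟨{t | c t ∈ X}, fun b => ?_⟩
    obtain ⟨i, hi, hbi, h⟩ := hX (Ordinal.ToType.mk.symm b).1 (Ordinal.ToType.mk.symm b).2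
    refine ⟨Ordinal.ToType.mk ⟨i, hi⟩, ?_, fun t ht => ?_⟩
    · rw [← OrderIso.symm_apply_le]
      exact hbi
    · have := h (c t) (by
        rw [ZFSet.mem_vonNeumann, Ordinal.rank_toZFSet]
        exact Ordinal.ToType.mk.symm.strictMono ht)
      rw [Set.mem_ofPred_eq, this, dif_pos hi, ZFSet.mem_range]
      constructor
      · rintro ⟨⟨s, hs⟩, hst⟩
        exact hc hst ▸ hs
      · exact fun h => ⟨⟨t, h⟩, rfl⟩

namespace HasBranchProperty

variable {T : Type u} [LinearOrder T] [WellFoundedLT T]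

protected theorem nonempty (hT : HasBranchProperty T) : Nonempty T :=
  mk_ne_zero_iff.1 (aleph0_pos.trans_le hT.aleph0_le).ne'

theorem mk_Iio_lt (hT : HasBranchProperty T) (b : T) : #(Set.Iio b) < #T := Cardinal.mk_Iio_lt b hT.ord_mk

theorem mk_Iic_lt (hT : HasBranchProperty T) (b : T) : #(Set.Iic b) < #T := by
  rw [← Set.Iio_insert]
  refine (mk_insert_le).trans_lt ?_
  exact add_lt_of_lt hT.aleph0_le (hT.mk_Iio_lt b) (one_lt_aleph0.trans_le hT.aleph0_le)

theorem exists_gt (hT : HasBranchProperty T) (b : T) : ∃ c, b < c := by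
  by_contra! h
  have := hT.mk_Iic_lt b
  rw [Set.eq_univ_of_forall (s := Set.Iic b) h, mk_univ] at this
  exact this.false

theorem exists_embedding_Iio (hT : HasBranchProperty T) {α : Type u} (hα : #α < #T) :
    ∃ b : T, Nonempty (α ↪ Set.Iio b) := by
  have h : (#α).ord < Ordinal.type (α := T) (· < ·) := by
    rw [← hT.ord_mk]; exact ord_lt_ord.2 hα
  refine ⟨Ordinal.enum (α := T) (· < ·) ⟨_, h⟩, ?_⟩
  rw [← Cardinal.le_def]
  have := Ordinal.typein_enum (α := T) (· < ·) h
  have h2 := congrArg Ordinal.card this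
  rw [card_ord] at h2
  exact h2.ge

/-- With `α` copied below a point `b₀`, a trace at any level past `b₀` determines the whole subset
of `α`. -/
theorem exists_unbounded_fiber (hT : HasBranchProperty T) {α : Type u} (hα : #α < #T) (F : T → Set α) :
    ∃ s, ∀ b, ∃ i, b ≤ i ∧ F i = s := by
  obtain ⟨b₀, ⟨e⟩⟩ := hT.exists_embedding_Iio hα
  let e' : α → T := fun a => (e a).1
  have he' : Function.Injective e' := Subtype.val_injective.comp e.injective
  obtain ⟨X, hX⟩ := hT.exists_branch fun i => e' '' F i
  refine ⟨e' ⁻¹' X, fun b => ?_⟩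
  obtain ⟨i, hi, h⟩ := hX (max b b₀)
  refine ⟨i, (le_max_left _ _).trans hi, ?_⟩
  ext a
  rw [Set.mem_preimage, h (e' a) ((e a).2.trans_le (le_max_right _ _)), he'.mem_set_image]

/-- This is regularity. If each `b` had some `g b` with `f (g b) > b`, then `g` would take one value
`a` at arbitrarily large `b`, in particular at some `b ≥ f a`. -/
theorem exists_bound (hT : HasBranchProperty T) {α : Type u} (hα : #α < #T) (f : α → T) : ∃ b, ∀ a, f a ≤ b := by
  by_contra! h
  choose g hg using h
  obtain ⟨s, hs⟩ := hT.exists_unbounded_fiber hα fun b => {g b}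
  obtain ⟨b₀⟩ := hT.nonempty
  obtain ⟨i, -, hi⟩ := hs b₀
  obtain ⟨j, hj, hij⟩ := hs (f (g i))
  have : g i = g j := Set.singleton_injective (hi.trans hij.symm)
  exact (hg j).not_ge (this ▸ hj)

/-- This is the strong limit property: a map from `T` to the subsets of a small set repeats a value
unboundedly often, so it is not injective. -/
theorem mk_set_lt (hT : HasBranchProperty T) {α : Type u} (hα : #α < #T) : #(Set α) < #T := by
  by_contra! h
  obtain ⟨F⟩ := Cardinal.le_def _ _ |>.1 h
  obtain ⟨s, hs⟩ := hT.exists_unbounded_fiber hα F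
  obtain ⟨b₀⟩ := hT.nonempty
  obtain ⟨i, -, hi⟩ := hs b₀
  obtain ⟨c, hc⟩ := hT.exists_gt i
  obtain ⟨j, hj, hij⟩ := hs c
  exact (hc.trans_le hj).ne (F.injective (hi.trans hij.symm))

/-- Stages can be chosen coherently: if at every level `j` the stages `i` have only few kinds
`c j i`, there is a choice of stages `σ j ≥ j` such that `σ j` and `σ j'` are of the same kind at
level `j`, for all `j ≤ j'`. -/
theorem exists_coherent_choice (hT : HasBranchProperty T) {Y : T → Type u} (hY : ∀ j, #(Y j) < #T) (c : ∀ j, T → Y j) :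
    ∃ σ : T → T, (∀ j, j ≤ σ j) ∧ ∀ j j', j ≤ j' → c j (σ j') = c j (σ j) := by
  have hpair : #(T × T) ≤ #T := by
    rw [mk_prod, lift_id, mul_eq_self hT.aleph0_le]
  obtain ⟨pair⟩ := Cardinal.le_def _ _ |>.1 hpair
  have e : ∀ j, Nonempty (Y j ↪ T) := fun j => Cardinal.le_def _ _ |>.1 (hY j).le
  -- Each pair of a level and a kind becomes its own point of `T`. A stage `i` is then the subset of
  -- `T` that contains exactly one code from each level.
  let g : ∀ j, Y j → T := fun j y => pair (j, (e j).some y)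
  have hg : ∀ {j j' y y'}, g j y = g j' y' → ∃ h : j = j', h ▸ y = y' := by
    intro j j' y y' h
    have h1 := Prod.ext_iff.1 (pair.injective h)
    obtain rfl : j = j' := h1.1
    exact ⟨rfl, (e j).some.injective h1.2⟩
  choose b₁ hb₁ using fun j => hT.exists_bound (hY j) (g j)
  choose b₂ hb₂ using fun j => hT.exists_bound (hT.mk_Iic_lt j) fun i : Set.Iic j => b₁ i
  -- `b₃ j` is strictly above the codes of all kinds at levels `≤ j`. Agreement with `X` below `b₃
  -- j` therefore decides the kinds at all these levels, whence `X` contains one code per level.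
  choose b₃ hb₃ using fun j => hT.exists_gt (max j (b₂ j))
  obtain ⟨X, hX⟩ := hT.exists_branch fun i => Set.range fun j => g j (c j i)
  choose σ hσ hσX using fun j => hX (b₃ j)
  have key : ∀ j j', j ≤ j' → ∀ y, g j y ∈ X ↔ y = c j (σ j') := by
    intro j j' hjj' y
    rw [hσX j' (g j y) ((((hb₁ j y).trans (hb₂ j' ⟨j, hjj'⟩)).trans (le_max_right _ _)).trans_lt
      (hb₃ j'))]
    constructor
    · rintro ⟨k, hk⟩
      obtain ⟨rfl, rfl⟩ := hg hk
      rfl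
    · rintro rfl
      exact ⟨j, rfl⟩
  refine ⟨σ, fun j => ((le_max_left _ _).trans (hb₃ j).le).trans (hσ j), fun j j' h => ?_⟩
  exact (key j j le_rfl _).1 ((key j j' h _).2 rfl)

end HasBranchProperty

/-! ### Unions of increasing families that need not be continuous -/

namespace AEC

open FirstOrder.Language

variable {L : FirstOrder.Language.{u, u}} {K : AEC L}

/-- `S ≺ T` for substructures of a structure `A`, which need not be in the class. -/
def StrongLE (K : AEC L) {A : Type u} [L.Structure A] (S T : L.Substructure A) : Prop :=
  S ≤ T ∧ K.Strong (S.comap T.subtype.toHom)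

section StrongLE

variable {A : Type u} [L.Structure A] {S T U : L.Substructure A}

theorem strong_comap_iff (h : S ≤ T) :
    K.Strong (S.comap T.subtype.toHom) ↔ K.IsKEmb (Substructure.inclusion h) := by
  have e : (Substructure.inclusion h).toHom.range = S.comap T.subtype.toHom := by
    ext x
    simp only [Hom.mem_range, Substructure.mem_comap]
    constructor
    · rintro ⟨y, rfl⟩
      exact y.2
    · intro hx
      exact ⟨⟨x.1, hx⟩, rfl⟩
  unfold IsKEmb
  rw [e]

theorem StrongLE.isKEmb (h : K.StrongLE S T) : K.IsKEmb (Substructure.inclusion h.1) :=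
  (strong_comap_iff h.1).1 h.2

theorem StrongLE.mem_left (h : K.StrongLE S T) : K.Mem S := h.isKEmb.mem_left

theorem StrongLE.mem_right (h : K.StrongLE S T) : K.Mem T := h.isKEmb.mem_right

theorem StrongLE.refl (h : K.Mem S) : K.StrongLE S S :=
  ⟨le_rfl, (strong_comap_iff le_rfl).2 (IsKEmb.refl h)⟩

theorem StrongLE.trans (h : K.StrongLE S T) (h' : K.StrongLE T U) : K.StrongLE S U :=
  ⟨h.1.trans h'.1, (strong_comap_iff (h.1.trans h'.1)).2 (h'.isKEmb.comp h.isKEmb)⟩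

theorem Strong.strongLE (hS : K.Strong S) (hT : K.Strong T) (h : S ≤ T) : K.StrongLE S T :=
  ⟨h, K.coherence hS hT h⟩

theorem StrongLE.strong (h : K.StrongLE S T) (hT : K.Strong T) : K.Strong S := by
  have := K.strong_trans h.2 hT
  convert this
  ext x
  simp only [Substructure.mem_map, Substructure.mem_comap]
  exact ⟨fun hx => ⟨⟨x, h.1 hx⟩, hx, rfl⟩, by rintro ⟨y, hy, rfl⟩; exact hy⟩

/-- A substructure of `S ≤ U`, seen as a substructure of `U`. -/
def equivComap (h : S ≤ U) : S ≃[L] S.comap U.subtype.toHom where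
  toFun x := ⟨⟨x.1, h x.2⟩, x.2⟩
  invFun x := ⟨x.1.1, x.2⟩
  left_inv _ := rfl
  right_inv _ := rfl
  map_fun' _ _ := rfl
  map_rel' _ _ := Iff.rfl

theorem StrongLE.comap (h : K.StrongLE S T) (hT : T ≤ U) :
    K.StrongLE (S.comap U.subtype.toHom) (T.comap U.subtype.toHom) := by
  refine ⟨fun x hx => h.1 hx, ?_⟩
  have := K.strong_iso (equivComap hT) h.2
  convert this using 1
  ext x
  simp only [Substructure.mem_comap, Substructure.mem_map]
  constructor
  · intro hx
    exact ⟨⟨x.1.1, x.2⟩, hx, rfl⟩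
  · rintro ⟨y, hy, rfl⟩
    exact hy

theorem isStrongChain_comap {α : Ordinal.{u}} {S : Ordinal.{u} → L.Substructure A}
    (hle : ∀ j < α, ∀ i ≤ j, K.StrongLE (S i) (S j))
    (hlim : ∀ δ < α, Order.IsSuccLimit δ → (S δ : Set A) = ⋃ i ∈ Set.Iio δ, (S i : Set A))
    (hU : ∀ i < α, S i ≤ U) :
    IsStrongChain K.Mem K.Strong α fun i => (S i).comap U.subtype.toHom := by
  refine ⟨fun i hi => K.mem_iso (equivComap (hU i hi)) (hle i hi i le_rfl).mem_left,
    fun i j hij hj => (hle j hj i hij).comap (hU j hj), fun δ hδ hl => ?_⟩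
  ext x
  have := Set.ext_iff.1 (hlim δ hδ hl) x.1
  simpa using this

end StrongLE

section Union

variable {A : Type u} [L.Structure A] {α : Ordinal.{u}} {S : Ordinal.{u} → L.Substructure A}

/-- The continuous chain that interpolates an increasing chain `S`. -/
noncomputable def interpolate (S : Ordinal.{u} → L.Substructure A) (i : Ordinal.{u}) :
    L.Substructure A :=
  -- The maximum with `1` makes stage `0` equal to `S 0` and not the empty supremum. Stage `t + 1`
  -- is `S t`, which leaves the limit stages free to be unions.
  ⨆ t : Set.Iio (max i 1), S t

theorem mem_interpolate (hα : 0 < α) (hle : ∀ i j, i ≤ j → j < α → K.StrongLE (S i) (S j))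
    {i : Ordinal.{u}} (hi : i ≤ α) {x : A} :
    x ∈ interpolate S i ↔ ∃ t < max i 1, x ∈ S t := by
  have hmax : max i 1 ≤ α := max_le hi (Order.one_le_iff_pos.2 hα)
  have : Nonempty (Set.Iio (max i 1)) := ⟨⟨0, by simp⟩⟩
  unfold interpolate
  rw [Substructure.mem_iSup_of_directed]
  · simp
  · intro a b
    rcases le_total a.1 b.1 with h | h
    · exact ⟨b, (hle _ _ h (b.2.trans_le hmax)).1, le_rfl⟩
    · exact ⟨a, le_rfl, (hle _ _ h (a.2.trans_le hmax)).1⟩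

theorem interpolate_zero (hα : 0 < α) (hle : ∀ i j, i ≤ j → j < α → K.StrongLE (S i) (S j)) :
    interpolate S 0 = S 0 := by
  ext x
  rw [mem_interpolate hα hle zero_le]
  simp

theorem interpolate_succ (hle : ∀ i j, i ≤ j → j < α → K.StrongLE (S i) (S j)) {t : Ordinal.{u}}
    (ht : t < α) : interpolate S (Order.succ t) = S t := by
  ext x
  rw [mem_interpolate (zero_le.trans_lt ht) hle (Order.succ_le_of_lt ht)]
  have : max (Order.succ t) 1 = Order.succ t :=
    max_eq_left (Order.one_le_iff_pos.2 (zero_le.trans_lt (Order.lt_succ t)))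
  rw [this]
  constructor
  · rintro ⟨s, hs, hx⟩
    exact (hle s t (Order.lt_succ_iff.1 hs) ht).1 hx
  · exact fun h => ⟨t, Order.lt_succ t, h⟩

theorem coe_interpolate_limit (hα : 0 < α)
    (hle : ∀ i j, i ≤ j → j < α → K.StrongLE (S i) (S j)) {δ : Ordinal.{u}}
    (hδ : δ ≤ α) (hl : Order.IsSuccLimit δ) :
    (interpolate S δ : Set A) = ⋃ i ∈ Set.Iio δ, (interpolate S i : Set A) := by
  have h1 : (1 : Ordinal) < δ := Ordinal.one_lt_of_isSuccLimit hl
  ext x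
  simp only [SetLike.mem_coe, Set.mem_iUnion, Set.mem_Iio, exists_prop]
  rw [mem_interpolate hα hle hδ, max_eq_left h1.le]
  constructor
  · rintro ⟨t, ht, hx⟩
    exact ⟨Order.succ t, hl.succ_lt ht, by rwa [interpolate_succ hle (ht.trans_le hδ)]⟩
  · rintro ⟨i, hi, hx⟩
    rw [mem_interpolate hα hle (hi.le.trans hδ)] at hx
    obtain ⟨t, ht, hx⟩ := hx
    exact ⟨t, ht.trans (max_lt hi h1), hx⟩

theorem interpolate_mono (hα : 0 < α)
    (hle : ∀ i j, i ≤ j → j < α → K.StrongLE (S i) (S j)) {i j : Ordinal.{u}} (hij : i ≤ j)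
    (hj : j ≤ α) : interpolate S i ≤ interpolate S j := by
  intro x hx
  rw [mem_interpolate hα hle (hij.trans hj)] at hx
  rw [mem_interpolate hα hle hj]
  obtain ⟨t, ht, hx⟩ := hx
  exact ⟨t, ht.trans_le (max_le_max_right _ hij), hx⟩

/-- The proof is by induction on `j`. At a limit `j`, `union_mem` applies to the chain below. At a
successor `t + 1`, where the stage is `S t`, a second induction on `i` is needed: a limit `i ≤ t` is
a union of strong submodels of `S t`, so `union_strong` applies inside `S t`. -/
theorem interpolate_strongLE (hα : 0 < α)
    (hle : ∀ i j, i ≤ j → j < α → K.StrongLE (S i) (S j)) (j : Ordinal.{u}) :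
    j ≤ α → ∀ i ≤ j, K.StrongLE (interpolate S i) (interpolate S j) := by
  induction j using WellFoundedLT.induction with
  | _ j ihj =>
  intro hj
  rcases Ordinal.zero_or_succ_or_isSuccLimit j with rfl | ⟨t, rfl⟩ | hl
  · intro i hi
    obtain rfl : i = 0 := le_antisymm hi zero_le
    rw [interpolate_zero hα hle]
    exact hle 0 0 le_rfl hα
  · have ht : t < α := Order.succ_le_iff.1 hj
    rw [interpolate_succ hle ht]
    intro i
    induction i using WellFoundedLT.induction with
    | _ i ihi =>
    intro hi
    rcases Ordinal.zero_or_succ_or_isSuccLimit i with rfl | ⟨s, rfl⟩ | hl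
    · rw [interpolate_zero hα hle]
      exact hle 0 t zero_le ht
    · have hst := Order.succ_le_succ_iff.1 hi
      rw [interpolate_succ hle (hst.trans_lt ht)]
      exact hle s t hst ht
    · have hle' : ∀ k < i, k ≤ Order.succ t := fun k hk => hk.le.trans hi
      have hit : i ≤ t := by
        rcases hi.lt_or_eq with h | rfl
        · exact Order.lt_succ_iff.1 h
        · exact absurd hl (Order.not_isSuccLimit_succ t)
      have hsub : interpolate S i ≤ S t := by
        rw [← interpolate_succ hle ht]; exact interpolate_mono hα hle hi hj
      refine ⟨hsub, K.union_strong i (fun k => (interpolate S k).comap (S t).subtype.toHom) _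
        hl.bot_lt (isStrongChain_comap (fun k hk l hl => ?_) (fun δ hδ => ?_) ?_) ?_ ?_⟩
      · exact ihj k (Order.lt_succ_iff.2 (hk.le.trans hit)) ((hk.le.trans hi).trans hj) l hl
      · exact coe_interpolate_limit hα hle ((hδ.le.trans hi).trans hj)
      · exact fun k hk => (interpolate_mono hα hle hk.le (hi.trans hj)).trans hsub
      · exact fun k hk => (ihi k hk (hle' k hk)).2
      · ext x
        have := Set.ext_iff.1 (coe_interpolate_limit hα hle (hi.trans hj) hl) x.1
        simpa using this
  · have h := K.union_mem j (fun k => (interpolate S k).comap (interpolate S j).subtype.toHom)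
      hl.bot_lt (isStrongChain_comap (fun k hk l hl => ihj k hk (hk.le.trans hj) l hl)
        (fun δ hδ => coe_interpolate_limit hα hle (hδ.le.trans hj))
        fun k hk => interpolate_mono hα hle hk.le hj) (by
          ext x
          have := Set.ext_iff.1 (coe_interpolate_limit hα hle hj hl) x.1
          simpa using this)
    intro i hi
    rcases hi.lt_or_eq with h' | rfl
    · exact ⟨interpolate_mono hα hle hi hj, h.2 i h'⟩
    · exact StrongLE.refl h.1

theorem strong_interpolate (hα : 0 < α)
    (hle : ∀ i j, i ≤ j → j < α → K.StrongLE (S i) (S j)) (hS : ∀ i < α, K.Strong (S i))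
    (i : Ordinal.{u}) : i ≤ α → K.Strong (interpolate S i) := by
  induction i using WellFoundedLT.induction with
  | _ i ihi =>
  intro hi
  rcases Ordinal.zero_or_succ_or_isSuccLimit i with rfl | ⟨s, rfl⟩ | hl
  · rw [interpolate_zero hα hle]
    exact hS 0 hα
  · have hs : s < α := Order.succ_le_iff.1 hi
    rw [interpolate_succ hle hs]
    exact hS s hs
  · exact K.union_strong i (interpolate S) _ hl.bot_lt
      ⟨fun k hk => (K.mem_of_strong (ihi k hk (hk.le.trans hi))).1,
        fun k l hkl hl => interpolate_strongLE hα hle l (hl.le.trans hi) k hkl,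
        fun δ hδ => coe_interpolate_limit hα hle (hδ.le.trans hi)⟩
      (fun k hk => ihi k hk (hk.le.trans hi)) (coe_interpolate_limit hα hle hi hl)

end Union

section WellOrder

variable {T : Type u} [LinearOrder T] [WellFoundedLT T] {A : Type u} [L.Structure A]

/-- The family `S`, reindexed by the ordinals below the order type of `T`. -/
noncomputable def reindex (S : T → L.Substructure A) (i : Ordinal.{u}) : L.Substructure A :=
  open Classical in
  if h : i < Ordinal.type (α := T) (· < ·) then S (Ordinal.enum (α := T) (· < ·) ⟨i, h⟩) else ⊥

variable {S : T → L.Substructure A}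

theorem reindex_of_lt {i : Ordinal.{u}} (h : i < Ordinal.type (α := T) (· < ·)) :
    reindex S i = S (Ordinal.enum (α := T) (· < ·) ⟨i, h⟩) := dif_pos h

theorem reindex_typein (t : T) : reindex S (Ordinal.typein (α := T) (· < ·) t) = S t := by
  rw [reindex_of_lt (Ordinal.typein_lt_type _ t), Ordinal.enum_typein]

theorem reindex_strongLE (hle : ∀ i j, i ≤ j → K.StrongLE (S i) (S j)) (i j : Ordinal.{u})
    (hij : i ≤ j) (hj : j < Ordinal.type (α := T) (· < ·)) :
    K.StrongLE (reindex S i) (reindex S j) := by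
  rw [reindex_of_lt hj, reindex_of_lt (hij.trans_lt hj)]
  exact hle _ _ (not_lt.1 ((Ordinal.enum_le_enum _).2 hij))

theorem type_pos [Nonempty T] : 0 < Ordinal.type (α := T) (· < ·) :=
  (Ordinal.type_ne_zero_of_nonempty _).bot_lt

theorem interpolate_reindex [Nonempty T] (hle : ∀ i j, i ≤ j → K.StrongLE (S i) (S j))
    {U : L.Substructure A} (hU : (U : Set A) = ⋃ t, (S t : Set A)) :
    interpolate (reindex S) (Ordinal.type (α := T) (· < ·)) = U := by
  ext x
  rw [mem_interpolate type_pos (reindex_strongLE hle) le_rfl,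
    max_eq_left (Order.one_le_iff_pos.2 type_pos), ← SetLike.mem_coe, hU, Set.mem_iUnion]
  constructor
  · rintro ⟨t, ht, hx⟩
    rw [reindex_of_lt ht] at hx
    exact ⟨_, hx⟩
  · rintro ⟨t, hx⟩
    exact ⟨_, Ordinal.typein_lt_type _ t, by rwa [reindex_typein]⟩

/-- `S t` occurs in the interpolated chain one stage after its own index, and the union is the final
stage. -/
theorem strongLE_union [Nonempty T] (hle : ∀ i j, i ≤ j → K.StrongLE (S i) (S j))
    {U : L.Substructure A} (hU : (U : Set A) = ⋃ t, (S t : Set A)) (t : T) :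
    K.StrongLE (S t) U := by
  have := interpolate_strongLE type_pos (reindex_strongLE hle) _ le_rfl _
    (Order.succ_le_of_lt (Ordinal.typein_lt_type (α := T) (· < ·) t))
  rwa [interpolate_reindex hle hU, interpolate_succ (reindex_strongLE hle)
    (Ordinal.typein_lt_type _ t), reindex_typein] at this

theorem strong_union [Nonempty T] (hmono : Monotone S) (hS : ∀ t, K.Strong (S t))
    {U : L.Substructure A} (hU : (U : Set A) = ⋃ t, (S t : Set A)) : K.Strong U := by
  have hle : ∀ i j, i ≤ j → K.StrongLE (S i) (S j) := fun i j h => (hS i).strongLE (hS j) (hmono h)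
  rw [← interpolate_reindex hle hU]
  refine strong_interpolate type_pos (reindex_strongLE hle) (fun i hi => ?_) _ le_rfl
  rw [reindex_of_lt hi]
  exact hS _

/-- Löwenheim–Skolem, increasingly: a family of small subsets can be covered by an increasing
family of small strong substructures. -/
theorem exists_monotone_strong {N Ω : Type u} [L.Structure N] (hN : K.Mem N) {W : T → Set Ω}
    (hW : Monotone W) (hLS : ∀ j, K.LS ≤ #(W j)) (hT : ∀ j, #(Set.Iio j) ≤ #(W j))
    {X : T → Set N} (hX : ∀ j, #(X j) ≤ #(W j)) :
    ∃ P : T → L.Substructure N, Monotone P ∧ ∀ j, K.Strong (P j) ∧ X j ⊆ P j ∧ #(P j) ≤ #(W j) := by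
  choose hull hull_strong subset_hull card_hull using K.hasLSProperty_LS.2 N hN
  -- Each hull swallows all the earlier ones. Nothing is asked at limits, since `interpolate`
  -- supplies continuity where it is needed.
  let P : T → L.Substructure N := WellFoundedLT.fix fun j ih =>
    hull (X j ∪ ⋃ i : Set.Iio j, ih i.1 i.2)
  have hP : ∀ j, P j = hull (X j ∪ ⋃ i : Set.Iio j, P i) := fun j => WellFoundedLT.fix_eq _ j
  refine ⟨P, fun i j hij => ?_, fun j => ⟨?_, ?_, ?_⟩⟩
  · rcases hij.lt_or_eq with h | rfl
    · rw [hP j]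
      intro x hx
      exact subset_hull _ (.inr (Set.mem_iUnion.2 ⟨⟨i, h⟩, hx⟩))
    · exact le_rfl
  · rw [hP]; exact hull_strong _
  · rw [hP]; exact Set.subset_union_left.trans (subset_hull _)
  · induction j using WellFoundedLT.induction with
    | _ j ih =>
    have hinf : ℵ₀ ≤ #(W j) := (le_add_self.trans K.hasLSProperty_LS.1).trans (hLS j)
    rw [hP]
    refine (card_hull _).trans (add_le_of_le hinf ((mk_union_le _ _).trans
      (add_le_of_le hinf (hX j) ?_)) (hLS j))
    refine (mk_iUnion_le _).trans ((mul_le_mul' (hT j) (ciSup_le' fun i => ?_)).trans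
      (mul_eq_self hinf).le)
    exact (ih i.1 i.2).trans (mk_le_mk_of_subset (hW (le_of_lt i.2)))

end WellOrder

/-! ### Labelled structures, their atomic diagrams and their limits -/

/-- `s` is the underlying set of a strong substructure of `N`. -/
def StrongSet (K : AEC L) {N : Type u} [L.Structure N] (s : Set N) : Prop :=
  ∃ S : L.Substructure N, K.Strong S ∧ (S : Set N) = s

theorem isKEmb_iff {M N : Type u} [L.Structure M] [L.Structure N] {f : M ↪[L] N} :
    K.IsKEmb f ↔ K.StrongSet (Set.range f) := by
  constructor
  · exact fun h => ⟨_, h, by ext x; simp⟩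
  · rintro ⟨S, hS, e⟩
    have : f.toHom.range = S := SetLike.ext' (by rw [e]; ext x; simp)
    unfold IsKEmb
    rwa [this]

/-- The image of a strong subset under a `K`-embedding is strong. -/
theorem StrongSet.image {M N : Type u} [L.Structure M] [L.Structure N] {f : M ↪[L] N}
    (hf : K.IsKEmb f) {s : Set M} : K.StrongSet s → K.StrongSet (f '' s) := by
  rintro ⟨S, hS, rfl⟩
  have := isKEmb_iff.1 (hf.comp (isKEmb_subtype hS))
  convert this using 1
  ext x
  simp

theorem StrongSet.iUnion {T : Type u} [LinearOrder T] [WellFoundedLT T] [Nonempty T]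
    {N : Type u} [L.Structure N] {s : T → Set N} (hmono : Monotone s)
    (hs : ∀ t, K.StrongSet (s t)) : K.StrongSet (⋃ t, s t) := by
  choose S hS e using hs
  have hm : Monotone S := fun i j h => by
    rw [← SetLike.coe_subset_coe, e, e]; exact hmono h
  have hU : ((⨆ t, S t : L.Substructure N) : Set N) = ⋃ t, s t := by
    ext x
    rw [SetLike.mem_coe, Substructure.mem_iSup_of_directed hm.directed_le]
    simp [← e]
  exact ⟨⨆ t, S t, strong_union hm hS (hU.trans (by simp [e])), hU⟩

/-- The labellings `l` and `l'` of two structures satisfy the same atomic formulas, in the labels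
from `s`. -/
structure SameDiag (L : FirstOrder.Language.{u, u}) {Λ N N' : Type u} [L.Structure N]
    [L.Structure N'] (s : Set Λ) (l : Λ → N) (l' : Λ → N') : Prop where
  eq_iff : ∀ x ∈ s, ∀ y ∈ s, l x = l y ↔ l' x = l' y
  rel_iff : ∀ {n : ℕ} (R : L.Relations n) (x : Fin n → Λ), (∀ i, x i ∈ s) →
    (Structure.RelMap R (l ∘ x) ↔ Structure.RelMap R (l' ∘ x))
  fun_iff : ∀ {n : ℕ} (F : L.Functions n) (x : Fin n → Λ), (∀ i, x i ∈ s) → ∀ y ∈ s,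
    (Structure.funMap F (l ∘ x) = l y ↔ Structure.funMap F (l' ∘ x) = l' y)

namespace SameDiag

variable {Λ Λ' N N' N'' : Type u} [L.Structure N] [L.Structure N'] [L.Structure N'']
  {s t : Set Λ} {l : Λ → N} {l' : Λ → N'} {l'' : Λ → N''}

theorem symm (h : SameDiag L s l l') : SameDiag L s l' l :=
  ⟨fun x hx y hy => (h.eq_iff x hx y hy).symm, fun R x hx => (h.rel_iff R x hx).symm,
    fun F x hx y hy => (h.fun_iff F x hx y hy).symm⟩

theorem trans (h : SameDiag L s l l') (h' : SameDiag L s l' l'') : SameDiag L s l l'' :=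
  ⟨fun x hx y hy => (h.eq_iff x hx y hy).trans (h'.eq_iff x hx y hy),
    fun R x hx => (h.rel_iff R x hx).trans (h'.rel_iff R x hx),
    fun F x hx y hy => (h.fun_iff F x hx y hy).trans (h'.fun_iff F x hx y hy)⟩

theorem mono (h : SameDiag L t l l') (hst : s ⊆ t) : SameDiag L s l l' :=
  ⟨fun x hx y hy => h.eq_iff x (hst hx) y (hst hy), fun R x hx => h.rel_iff R x fun i => hst (hx i),
    fun F x hx y hy => h.fun_iff F x (fun i => hst (hx i)) y (hst hy)⟩

theorem comp (h : SameDiag L s l l') {f : Λ' → Λ} {t : Set Λ'} (hf : ∀ x ∈ t, f x ∈ s) :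
    SameDiag L t (l ∘ f) (l' ∘ f) :=
  ⟨fun x hx y hy => h.eq_iff _ (hf x hx) _ (hf y hy),
    fun R x hx => h.rel_iff R (f ∘ x) fun i => hf _ (hx i),
    fun F x hx y hy => h.fun_iff F (f ∘ x) (fun i => hf _ (hx i)) _ (hf y hy)⟩

theorem of_embedding (f : N ↪[L] N') (h : ∀ x ∈ s, l' x = f (l x)) : SameDiag L s l l' := by
  have hc : ∀ {n : ℕ} (x : Fin n → Λ), (∀ i, x i ∈ s) → l' ∘ x = f ∘ l ∘ x :=
    fun x hx => funext fun i => h _ (hx i)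
  refine ⟨fun x hx y hy => ?_, fun R x hx => ?_, fun F x hx y hy => ?_⟩
  · rw [h x hx, h y hy, f.injective.eq_iff]
  · rw [hc x hx, f.map_rel]
  · rw [hc x hx, ← f.map_fun, h y hy, f.injective.eq_iff]

theorem of_subtype (h : SameDiag L Set.univ (fun x : s => l x) fun x : s => l' x) :
    SameDiag L s l l' :=
  ⟨fun x hx y hy => h.eq_iff ⟨x, hx⟩ trivial ⟨y, hy⟩ trivial,
    fun R x hx => h.rel_iff R (fun i => ⟨x i, hx i⟩) fun _ => trivial,
    fun F x hx y hy => h.fun_iff F (fun i => ⟨x i, hx i⟩) (fun _ => trivial) ⟨y, hy⟩ trivial⟩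

/-- Send an element to the value under `l'` of any of its labels; the equality clause makes the
choice of label immaterial. -/
theorem exists_embedding (h : SameDiag L Set.univ l l') (hl : Function.Surjective l) :
    ∃ f : N ↪[L] N', ∀ x, f (l x) = l' x := by
  choose g hg using hl
  have key : ∀ x, l' (g (l x)) = l' x := fun x =>
    (h.eq_iff _ (Set.mem_univ _) _ (Set.mem_univ _)).1 (hg (l x))
  have hc : ∀ {n : ℕ} (x : Fin n → N), l ∘ g ∘ x = x := fun x => funext fun i => hg _
  refine ⟨{ toFun := fun y => l' (g y), inj' := fun x y hxy => ?_, map_fun' := fun F x => ?_,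
            map_rel' := fun R x => ?_ }, key⟩
  · rw [← hg x, ← hg y]
    exact (h.eq_iff _ (Set.mem_univ _) _ (Set.mem_univ _)).2 hxy
  · refine ((h.fun_iff F (g ∘ x) (fun _ => Set.mem_univ _) _ (Set.mem_univ _)).1 ?_).symm
    rw [hc, hg]
  · have := h.rel_iff R (g ∘ x) fun _ => Set.mem_univ _
    rw [hc] at this
    exact this.symm

/-- Kinds of zigzags will be recorded as sets of formulas, of which only the atomic ones matter. -/
theorem of_realize_formula (h : ∀ φ : L.Formula s, φ.Realize (fun x => l x) ↔
    φ.Realize fun x => l' x) : SameDiag L s l l' := by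
  refine ⟨fun x hx y hy => ?_, fun {n} R x hx => ?_, fun {n} F x hx y hy => ?_⟩
  · simpa using h ((var ⟨x, hx⟩ : L.Term s).equal (var ⟨y, hy⟩))
  · simpa [Function.comp_def] using h (R.formula fun i => var ⟨x i, hx i⟩)
  · simpa [Function.comp_def] using h ((func F fun i => var ⟨x i, hx i⟩ : L.Term s).equal (var ⟨y, hy⟩))

/-- An atomic formula mentions finitely many labels, so a single level contains them all. -/
theorem of_directed {T : Type u} [LinearOrder T] [Nonempty T] {F : T → Set Λ} (hF : Monotone F)
    (hcov : ∀ x, ∃ j, x ∈ F j) (h : ∀ j, SameDiag L (F j) l l') : SameDiag L Set.univ l l' := by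
  have hfin : ∀ {n : ℕ} (x : Fin n → Λ), ∃ j, ∀ i, x i ∈ F j := by
    intro n x
    choose j hj using fun i => hcov (x i)
    obtain ⟨k, hk⟩ := Finite.exists_le j
    exact ⟨k, fun i => hF (hk i) (hj i)⟩
  refine ⟨fun x _ y _ => ?_, fun R x _ => ?_, fun G x _ y _ => ?_⟩
  · obtain ⟨j, hj⟩ := hfin ![x, y]
    exact (h j).eq_iff x (hj 0) y (hj 1)
  · obtain ⟨j, hj⟩ := hfin x
    exact (h j).rel_iff R x hj
  · obtain ⟨j, hj⟩ := hfin x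
    obtain ⟨k, hk⟩ := hcov y
    exact (h (max j k)).fun_iff G x (fun i => hF (le_max_left _ _) (hj i)) y
      (hF (le_max_right _ _) hk)

end SameDiag

/-- Labellings of `N` and `N'` by the same labels that satisfy the same atomic formulas and map the
members of a cover by label sets to strong subsets of `N'` induce a `K`-embedding. -/
theorem exists_isKEmb {Λ N N' T : Type u} [L.Structure N] [L.Structure N'] [LinearOrder T]
    [WellFoundedLT T] [Nonempty T] {F : T → Set Λ} (hF : Monotone F) (hcov : ∀ x, ∃ j, x ∈ F j)
    {l : Λ → N} {l' : Λ → N'} (hl : Function.Surjective l) (h : ∀ j, SameDiag L (F j) l l')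
    (hs : ∀ j, K.StrongSet (l' '' F j)) : ∃ f : N ↪[L] N', K.IsKEmb f ∧ ∀ x, f (l x) = l' x := by
  obtain ⟨f, hf⟩ := (SameDiag.of_directed hF hcov h).exists_embedding hl
  refine ⟨f, isKEmb_iff.2 ?_, hf⟩
  convert StrongSet.iUnion (fun i j hij => Set.image_mono (hF hij)) hs
  ext y
  simp only [Set.mem_range, Set.mem_iUnion, Set.mem_image]
  constructor
  · rintro ⟨z, rfl⟩
    obtain ⟨x, rfl⟩ := hl z
    obtain ⟨j, hj⟩ := hcov x
    exact ⟨j, x, hj, (hf x).symm⟩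
  · rintro ⟨j, x, -, rfl⟩
    exact ⟨_, hf x⟩

theorem StrongSet.preimage_val {N : Type u} [L.Structure N] {s : Set N} (hs : K.StrongSet s)
    {S : L.Substructure N} (hS : K.Strong S) (h : s ⊆ S) :
    K.StrongSet ((↑) ⁻¹' s : Set S) := by
  obtain ⟨S', hS', rfl⟩ := hs
  exact ⟨_, K.coherence hS' hS h, rfl⟩

/-- The maps into a direct limit of `K`-embeddings, along a well-order, are `K`-embeddings. -/
theorem isKEmb_directLimit_of {T : Type u} [LinearOrder T] [WellFoundedLT T] [Nonempty T]
    {G : T → Type u} [∀ j, L.Structure (G j)] (f : ∀ i j, i ≤ j → G i ↪[L] G j)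
    [DirectedSystem G fun i j h => f i j h] (hf : ∀ i j h, K.IsKEmb (f i j h)) (j : T) :
    K.IsKEmb (FirstOrder.Language.DirectLimit.of L T G f j) := by
  let o := FirstOrder.Language.DirectLimit.of L T G f
  have hle : ∀ i j, i ≤ j → K.StrongLE (o i).toHom.range (o j).toHom.range := by
    intro i j h
    have hof : ∀ x, o j (f i j h x) = o i x := fun x => FirstOrder.Language.DirectLimit.of_f
    refine ⟨?_, ?_⟩
    · rintro _ ⟨x, rfl⟩
      exact ⟨f i j h x, hof x⟩
    · convert K.strong_iso (o j).equivRange (hf i j h) using 1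
      ext y
      obtain ⟨y, rfl⟩ := (o j).equivRange.surjective y
      simp only [Substructure.mem_comap, Substructure.mem_map, Hom.mem_range]
      constructor
      · rintro ⟨x, hx⟩
        refine ⟨f i j h x, ⟨x, rfl⟩, ?_⟩
        exact Subtype.ext ((hof x).trans hx)
      · rintro ⟨_, ⟨x, rfl⟩, hx⟩
        refine ⟨x, ?_⟩
        exact (hof x).symm.trans (congrArg Subtype.val hx)
  -- The limit is not yet known to be in `K`. Working with `StrongLE` into `⊤` yields membership
  -- together with strongness.
  have htop := strongLE_union hle (U := ⊤) (by
    ext y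
    obtain ⟨j, z, rfl⟩ := FirstOrder.Language.DirectLimit.exists_of y
    exact iff_of_true trivial (Set.mem_iUnion.2 ⟨j, z, rfl⟩)) j
  exact htop.strong (K.strong_refl _ (K.mem_iso Substructure.topEquiv htop.mem_right))

/-- A coherent system of labelled structures has a limit. -/
theorem exists_limit {Λ T : Type u} [LinearOrder T] [WellFoundedLT T] [Nonempty T]
    {F : T → Set Λ} (hF : Monotone F) (hcov : ∀ x, ∃ j, x ∈ F j)
    (N : T → Type u) [∀ j, L.Structure (N j)] (l : ∀ j, Λ → N j)
    (hstrong : ∀ i j, i ≤ j → K.StrongSet (l j '' F i))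
    (hsame : ∀ i j, i ≤ j → SameDiag L (F i) (l i) (l j)) :
    ∃ (N' : Type u) (_ : L.Structure N') (l' : Λ → N'), Function.Surjective l' ∧
      (∀ j, SameDiag L (F j) (l j) l') ∧
      ∀ j, ∀ s ⊆ F j, K.StrongSet (l j '' s) → K.StrongSet (l' '' s) := by
  choose S hS eS using fun j => hstrong j j le_rfl
  have hmem : ∀ j x, x ∈ F j → l j x ∈ S j := fun j x hx => by
    rw [← SetLike.mem_coe, eS]; exact Set.mem_image_of_mem _ hx
  -- Only the part `S j` of `N j` labelled by level `j` enters the limit. It is exhausted by its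
  -- labels, so they determine the transition maps and force them to commute.
  let l₀ : ∀ j, F j → S j := fun j x => ⟨l j x, hmem j x x.2⟩
  have hl₀ : ∀ j, Function.Surjective (l₀ j) := by
    rintro j ⟨y, hy⟩
    rw [← SetLike.mem_coe, eS] at hy
    obtain ⟨x, hx, rfl⟩ := hy
    exact ⟨⟨x, hx⟩, rfl⟩
  have hl₀' : ∀ j, SameDiag L Set.univ (l₀ j) fun x : F j => l j x := fun j =>
    .of_embedding (S j).subtype fun _ _ => rfl
  have hex : ∀ i j (h : i ≤ j), ∃ f : S i ↪[L] S j, ∀ x : F i, f (l₀ i x) = l₀ j ⟨x, hF h x.2⟩ := by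
    intro i j h
    refine SameDiag.exists_embedding (((hl₀' i).trans ((hsame i j h).comp (f := Subtype.val)
      fun x _ => x.2)).trans ?_) (hl₀ i)
    exact SameDiag.symm (.of_embedding (S j).subtype fun _ _ => rfl)
  choose f hf using hex
  have : DirectedSystem (fun j => S j) fun i j h => f i j h := by
    constructor
    · intro i x
      obtain ⟨x, rfl⟩ := hl₀ i x
      exact hf _ _ _ _
    · intro i j k hij hjk x
      obtain ⟨x, rfl⟩ := hl₀ _ x
      rw [hf, hf, hf]
  -- The image of `S i` in `S j` is `l j '' F i`, which is strong in `N j` by `hstrong`, hence in `S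
  -- j` by coherence.
  have hfK : ∀ i j h, K.IsKEmb (f i j h) := by
    intro i j h
    rw [isKEmb_iff]
    convert (hstrong i j h).preimage_val (hS j) ?_
    · ext y
      simp only [Set.mem_range, Set.mem_preimage, Set.mem_image]
      constructor
      · rintro ⟨x, rfl⟩
        obtain ⟨x, rfl⟩ := hl₀ i x
        exact ⟨x, x.2, by rw [hf]⟩
      · rintro ⟨x, hx, hxy⟩
        exact ⟨l₀ i ⟨x, hx⟩, by rw [hf]; exact Subtype.ext hxy⟩
    · rw [eS]
      exact Set.image_mono (hF h)
  let A := FirstOrder.Language.DirectLimit (fun j => S j) f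
  let o : ∀ j, S j ↪[L] A := FirstOrder.Language.DirectLimit.of L T (fun j => S j) f
  have hof : ∀ i j h x, o j (f i j h x) = o i x := fun i j h x => FirstOrder.Language.DirectLimit.of_f
  have hoK : ∀ j, K.IsKEmb (o j) := isKEmb_directLimit_of f hfK
  choose lev hlev using hcov
  let l' : Λ → A := fun x => o (lev x) (l₀ _ ⟨x, hlev x⟩)
  have hl' : ∀ j (x : F j), l' x = o j (l₀ j x) := by
    intro j x
    change o (lev x) (l₀ _ ⟨x, hlev x⟩) = _
    rcases le_total (lev x) j with h | h
    · rw [← hof _ _ h, hf]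
    · rw [← hof _ _ h, hf]
  refine ⟨A, inferInstance, l', ?_, fun j => ?_, fun j s hs => ?_⟩
  · intro y
    obtain ⟨j, z, rfl⟩ := FirstOrder.Language.DirectLimit.exists_of y
    obtain ⟨x, rfl⟩ := hl₀ j z
    exact ⟨x, hl' j x⟩
  · exact .of_subtype ((hl₀' j).symm.trans (.of_embedding (o j) fun x _ => hl' j x))
  · intro h
    have h1 := (h.preimage_val (hS j) (by rw [eS]; exact Set.image_mono hs)).image (hoK j)
    convert h1 using 1
    ext y
    simp only [Set.mem_image, Set.mem_preimage]
    constructor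
    · rintro ⟨x, hx, rfl⟩
      exact ⟨l₀ j ⟨x, hs hx⟩, ⟨x, hx, rfl⟩, (hl' j ⟨x, hs hx⟩).symm⟩
    · rintro ⟨z, ⟨x, hx, hxz⟩, rfl⟩
      refine ⟨x, hx, (hl' j ⟨x, hs hx⟩).trans (congrArg (o j) (Subtype.ext hxz))⟩

/-! ### Filtered label sets and labellings adapted to them -/

section Labels

variable {T Ω C C' : Type u}

/-- The filtration of a sum by the sums of the members of two filtrations. -/
def sumFilt (F : T → Set C) (G : T → Set C') (j : T) : Set (C ⊕ C') :=
  {x | Sum.elim (· ∈ F j) (· ∈ G j) x}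

theorem monotone_sumFilt [LinearOrder T] {F : T → Set C} {G : T → Set C'} (hF : Monotone F) (hG : Monotone G) :
    Monotone (sumFilt F G) := by
  rintro i j h (x | x) hx
  · exact hF h hx
  · exact hG h hx

theorem cover_sumFilt {F : T → Set C} {G : T → Set C'} (hF : ∀ x, ∃ j, x ∈ F j)
    (hG : ∀ x, ∃ j, x ∈ G j) (x : C ⊕ C') : ∃ j, x ∈ sumFilt F G j := by
  rcases x with x | x
  · exact hF x
  · exact hG x

theorem mk_sumFilt_le {F : T → Set C} {G : T → Set C'} {j : T} {c : Cardinal.{u}} (hc : ℵ₀ ≤ c)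
    (hF : #(F j) ≤ c) (hG : #(G j) ≤ c) : #(sumFilt F G j) ≤ c := by
  have : sumFilt F G j = Sum.inl '' F j ∪ Sum.inr '' G j := by
    ext (x | x) <;> simp [sumFilt]
  rw [this]
  exact (mk_union_le _ _).trans (add_le_of_le hc (mk_image_le.trans hF) (mk_image_le.trans hG))

variable [LinearOrder T]

/-- The labels `(i, w)` for the elements of the first `j` members of an increasing family. -/
def enumFilt (W : T → Set Ω) (j : T) : Set (T × Ω) :=
  {x | x.1 ≤ j ∧ x.2 ∈ W j}

theorem monotone_enumFilt {W : T → Set Ω} (hW : Monotone W) : Monotone (enumFilt W) :=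
  fun _ _ h _ hx => ⟨hx.1.trans h, hW h hx.2⟩

theorem mk_enumFilt_le {W : T → Set Ω} {j : T} (hc : ℵ₀ ≤ #(W j))
    (hT : #(Set.Iic j) ≤ #(W j)) : #(enumFilt W j) ≤ #(W j) := by
  have : #(enumFilt W j) ≤ #(Set.Iic j × W j) :=
    mk_le_of_injective (f := fun x => (⟨x.1.1, x.2.1⟩, ⟨x.1.2, x.2.2⟩)) (by
      intro x y h
      have h' := Prod.ext_iff.1 h
      exact Subtype.ext (Prod.ext (congrArg Subtype.val h'.1) (congrArg Subtype.val h'.2)))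
  refine this.trans ?_
  rw [mk_prod, lift_id, lift_id]
  exact (mul_le_mul' hT le_rfl).trans (mul_eq_self hc).le

/-- Conditions under which structures can be filtered by substructures of cardinalities `#(W j)`. -/
structure IsScale (K : AEC L) (W : T → Set Ω) : Prop where
  mono : Monotone W
  LS_le : ∀ j, K.LS ≤ #(W j)
  mk_Iic_le : ∀ j, #(Set.Iic j) ≤ #(W j)
  mk_lt : ∀ j, #(W j) < #T
  cover : ∀ x, ∃ j, x ∈ W j

theorem aleph0_le_LS (K : AEC L) : ℵ₀ ≤ K.LS := le_add_self.trans K.hasLSProperty_LS.1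

theorem IsScale.aleph0_le {W : T → Set Ω} (hW : K.IsScale W) (j : T) : ℵ₀ ≤ #(W j) :=
  (aleph0_le_LS K).trans (hW.LS_le j)

/-- A labelling of elements of `N` extends to a labelling for which the labels of each level label
a strong subset of `N`. -/
theorem exists_labelling [WellFoundedLT T] {W : T → Set Ω} (hW : K.IsScale W) {N : Type u}
    [L.Structure N] [Nonempty N] (hN : K.Mem N) {F : T → Set C}
    (hcard : ∀ j, #(F j) ≤ #(W j)) (c : C → N) :
    ∃ l : C ⊕ T × Ω → N, (∀ x, l (.inl x) = c x) ∧
      ∀ j, K.StrongSet (l '' sumFilt F (enumFilt W) j) := by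
  classical
  obtain ⟨d⟩ := ‹Nonempty N›
  obtain ⟨P, hPm, hP⟩ := exists_monotone_strong hN hW.mono hW.LS_le
    (fun j => (mk_le_mk_of_subset Set.Iio_subset_Iic_self).trans (hW.mk_Iic_le j))
    (X := fun j => insert d (c '' F j)) fun j => mk_insert_le.trans
      (add_le_of_le (hW.aleph0_le j) (mk_image_le.trans (hcard j))
        (one_lt_aleph0.le.trans (hW.aleph0_le j)))
  have hne : ∀ j, Nonempty (P j) := fun j => ⟨⟨d, (hP j).2.1 (Set.mem_insert _ _)⟩⟩
  have hsurj : ∀ j, ∃ g : W j → P j, Function.Surjective g := fun j => by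
    obtain ⟨g⟩ := Cardinal.le_def _ _ |>.1 (hP j).2.2
    exact ⟨Function.invFun g, Function.invFun_surjective g.injective⟩
  choose g hg using hsurj
  -- Level `j` asks only that `w ∈ W j`, so it may contain labels `(i, w)` with `w ∉ W i`. These get
  -- the value `d`, which was put into every `P j` for this purpose.
  let l : C ⊕ T × Ω → N :=
    Sum.elim c fun x => if h : x.2 ∈ W x.1 then g x.1 ⟨x.2, h⟩ else d
  refine ⟨l, fun x => rfl, fun j => ⟨P j, (hP j).1, ?_⟩⟩
  ext y
  constructor
  · intro hy
    obtain ⟨w, hw⟩ := hg j ⟨y, hy⟩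
    refine ⟨.inr (j, w), ⟨le_rfl, w.2⟩, ?_⟩
    simp [l, hw]
  · rintro ⟨x | ⟨i, w⟩, hx, rfl⟩
    · exact (hP j).2.1 (Set.mem_insert_of_mem _ ⟨x, hx, rfl⟩)
    · by_cases hw : w ∈ W i
      · simp only [l, Sum.elim_inr, hw, dite_true]
        exact hPm hx.1 (g i ⟨w, hw⟩).2
      · simp only [l, Sum.elim_inr, hw, dite_false]
        exact (hP j).2.1 (Set.mem_insert _ _)

theorem cover_enumFilt {W : T → Set Ω} (hW : K.IsScale W) (x : T × Ω) : ∃ j, x ∈ enumFilt W j := by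
  obtain ⟨j, hj⟩ := hW.cover x.2
  exact ⟨max x.1 j, le_max_left _ _, hW.mono (le_max_right _ _) hj⟩

end Labels

section Preimage

variable {X E R : Type u} [L.Structure X] [L.Structure E] [L.Structure R]

theorem StrongSet.preimage {f : E ↪[L] X} (hf : K.IsKEmb f) {s : Set X} (hs : K.StrongSet s)
    (h : s ⊆ Set.range f) : K.StrongSet (f ⁻¹' s) := by
  obtain ⟨S, hS, e⟩ := hs.preimage_val (S := f.toHom.range) hf (by intro x hx; simpa using h hx)
  refine ⟨_, K.strong_iso f.equivRange.symm hS, ?_⟩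
  ext x
  constructor
  · rintro ⟨y, hy, rfl⟩
    obtain ⟨x, rfl⟩ := f.equivRange.surjective y
    rw [e] at hy
    simpa using hy
  · intro hx
    refine ⟨f.equivRange x, ?_, by simp⟩
    rw [e]
    simpa using hx

/-- `K`-embeddings `e : E → X` and `f : E → R` give a partial labelling of `R` by `X`. -/
theorem exists_partial_labelling {e : E ↪[L] X} (he : K.IsKEmb e) {f : E ↪[L] R}
    (hf : K.IsKEmb f) (d : R) : ∃ c : X → R, (∀ y, c (e y) = f y) ∧
      SameDiag L (Set.range e) id c ∧
      ∀ s ⊆ Set.range e, K.StrongSet s → K.StrongSet (c '' s) := by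
  have hc : ∀ y, Function.extend e f (fun _ => d) (e y) = f y := e.injective.extend_apply f _
  refine ⟨Function.extend e f fun _ => d, hc, ?_, fun s hs h => ?_⟩
  · have h1 : SameDiag L Set.univ (id : E → E) e := .of_embedding e fun _ _ => rfl
    have h2 : SameDiag L Set.univ (id : E → E) f := .of_embedding f fun _ _ => rfl
    have h3 := h1.symm.trans h2
    obtain ⟨g, hg⟩ : ∃ g : Set.range e → E, ∀ x, e (g x) = x := by
      choose g hg using fun x : Set.range e => x.2
      exact ⟨g, hg⟩
    refine .of_subtype ?_
    convert h3.comp (f := g) (t := Set.univ) fun _ _ => trivial using 1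
    · funext x; exact (hg x).symm
    · funext x
      change _ = f (g x)
      rw [← hc, hg]
  · convert (h.preimage he hs).image hf using 1
    ext y
    constructor
    · rintro ⟨x, hx, rfl⟩
      obtain ⟨z, rfl⟩ := hs hx
      exact ⟨z, hx, (hc z).symm⟩
    · rintro ⟨z, hz, rfl⟩
      exact ⟨e z, hz, hc z⟩

end Preimage

/-! ### Zigzags of amalgams, filtrations of a type and labelled zigzags -/

section Zigzag

variable {I M : Type u} [L.Structure M]

/-- Past its end the zigzag stays constant, `AT` being reflexive. All zigzags are thus indexed by
`ℕ`, and their length is a separate number that can be made part of the kind. -/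
theorem Pretype.exists_zigzag {p q : K.Pretype I M} (h : p ≈ q) :
    ∃ (n : ℕ) (r : ℕ → K.Pretype I M), r 0 = p ∧ r n = q ∧ ∀ k, (r k).AT (r (k + 1)) := by
  change Relation.TransGen Pretype.AT p q at h
  induction h with
  | @single b h =>
    refine ⟨1, fun k => if k = 0 then p else b, rfl, rfl, fun k => ?_⟩
    rcases k with _ | k
    · exact h
    · exact Pretype.AT.refl b
  | @tail b c _ h ih =>
    obtain ⟨n, r, h0, hn, hr⟩ := ih
    refine ⟨n + 1, fun k => if k ≤ n then r k else c, by simpa, by simp, fun k => ?_⟩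
    rcases lt_trichotomy k n with hk | rfl | hk
    · simpa [hk.le, Nat.succ_le_of_lt hk] using hr k
    · simpa [hn] using h
    · simpa [hk.not_ge, (hk.trans (Nat.lt_succ_self k)).not_ge] using Pretype.AT.refl c

theorem Pretype.equiv_of_zigzag {r : ℕ → K.Pretype I M} (hr : ∀ k, (r k).AT (r (k + 1))) (n : ℕ) :
    r 0 ≈ r n := by
  induction n with
  | zero => exact Setoid.refl _
  | succ n ih => exact Setoid.trans ih (Relation.TransGen.single (hr n))

end Zigzag

end AEC

namespace AEC

open FirstOrder.Language

variable {L : FirstOrder.Language.{u, u}} {K : AEC L} {T Ω I M : Type u} [LinearOrder T]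
  [L.Structure M]

/-- An increasing family of strong substructures of `M`, given by `K`-embeddings, and of subsets of
`I`, given by injections. -/
structure Filtration (K : AEC L) (I M : Type u) [L.Structure M] (W : T → Set Ω) where
  E : T → Type u
  [str : ∀ j, L.Structure (E j)]
  e : ∀ j, E j ↪[L] M
  isKEmb : ∀ j, K.IsKEmb (e j)
  monotone_e : Monotone fun j => Set.range (e j)
  cover_e : ∀ m, ∃ j, m ∈ Set.range (e j)
  J : T → Type u
  s : ∀ j, J j ↪ I
  monotone_s : Monotone fun j => Set.range (s j)
  cover_s : ∀ m, ∃ j, m ∈ Set.range (s j)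
  -- Only the sum matters, as it is the size of a pretype of length `J j` over `E j`. Either summand
  -- may be the one that grows.
  card_eq : ∀ j, #(E j) + #(J j) = #(W j)

attribute [instance] Filtration.str

/-- An increasing family of restrictions of a pretype to the members of a filtration. -/
structure Resolution {W : T → Set Ω} (B : Filtration K I M W) (p : K.Pretype I M) where
  r : ∀ j, K.Pretype (B.J j) (B.E j)
  f : ∀ j, (r j).N ↪[L] p.N
  isKEmb : ∀ j, K.IsKEmb (f j)
  f_emb : ∀ j m, f j ((r j).emb m) = p.emb (B.e j m)
  f_a : ∀ j i, f j ((r j).a i) = p.a (B.s j i)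
  monotone_f : Monotone fun j => Set.range (f j)
  cover_f : ∀ m, ∃ j, m ∈ Set.range (f j)

/-- Sequences of structures `R 0, R 1, …` and `A 0, A 1, …`, those of the second kind being thought
of as amalgams of consecutive structures of the first kind, with elements labelled by `Λ`, `Λ'`. -/
structure LabelledZigzag (L : FirstOrder.Language.{u, u}) (Λ Λ' : Type u) where
  n : ℕ
  R : ℕ → Type u
  [strR : ∀ k, L.Structure (R k)]
  A : ℕ → Type u
  [strA : ∀ k, L.Structure (A k)]
  lR : ∀ k, Λ → R k
  lA : ∀ k, Λ' → A k

attribute [instance] LabelledZigzag.strR LabelledZigzag.strA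

section Labels

variable (T Ω) (p q : K.Pretype I M)

/-- Labels for elements given in advance: the elements of `Ω` label distinct elements, and `M`, `I`
and the models of `p` and `q` label their images. -/
abbrev GivenLabel := Ω ⊕ M ⊕ I ⊕ p.N ⊕ q.N

/-- Labels for the elements of a pretype. -/
abbrev TypeLabel := GivenLabel Ω p q ⊕ T × Ω

/-- Labels for the elements of an amalgam of two pretypes. -/
abbrev AmalgLabel := (TypeLabel T Ω p q ⊕ TypeLabel T Ω p q) ⊕ T × Ω

end Labels

variable {W : T → Set Ω} {B : Filtration K I M W} {p q : K.Pretype I M}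

/-- The filtration of `GivenLabel`. -/
def givenFilt (P : Resolution B p) (Q : Resolution B q) : T → Set (GivenLabel Ω p q) :=
  sumFilt W (sumFilt (fun j => Set.range (B.e j)) (sumFilt (fun j => Set.range (B.s j))
    (sumFilt (fun j => Set.range (P.f j)) (fun j => Set.range (Q.f j)))))

/-- The filtration of `TypeLabel`. -/
def typeFilt (P : Resolution B p) (Q : Resolution B q) : T → Set (TypeLabel T Ω p q) :=
  sumFilt (givenFilt P Q) (enumFilt W)

/-- The filtration of `AmalgLabel`. -/
def amalgFilt (P : Resolution B p) (Q : Resolution B q) : T → Set (AmalgLabel T Ω p q) :=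
  sumFilt (sumFilt (typeFilt P Q) (typeFilt P Q)) (enumFilt W)

section Filt

variable (P : Resolution B p) (Q : Resolution B q)

theorem monotone_typeFilt (hW : Monotone W) : Monotone (typeFilt P Q) :=
  monotone_sumFilt (monotone_sumFilt hW (monotone_sumFilt B.monotone_e (monotone_sumFilt
    B.monotone_s (monotone_sumFilt P.monotone_f Q.monotone_f)))) (monotone_enumFilt hW)

theorem monotone_amalgFilt (hW : Monotone W) : Monotone (amalgFilt P Q) :=
  monotone_sumFilt (monotone_sumFilt (monotone_typeFilt P Q hW) (monotone_typeFilt P Q hW))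
    (monotone_enumFilt hW)

theorem cover_typeFilt (hW : K.IsScale W) (x : TypeLabel T Ω p q) : ∃ j, x ∈ typeFilt P Q j :=
  cover_sumFilt (cover_sumFilt hW.cover (cover_sumFilt B.cover_e (cover_sumFilt B.cover_s
    (cover_sumFilt P.cover_f Q.cover_f)))) (cover_enumFilt hW) x

theorem cover_amalgFilt (hW : K.IsScale W) (x : AmalgLabel T Ω p q) : ∃ j, x ∈ amalgFilt P Q j :=
  cover_sumFilt (cover_sumFilt (cover_typeFilt P Q hW) (cover_typeFilt P Q hW))
    (cover_enumFilt hW) x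

theorem mk_givenFilt_le (hW : K.IsScale W) (j : T) : #(givenFilt P Q j) ≤ #(W j) := by
  have h := hW.aleph0_le j
  refine mk_sumFilt_le h le_rfl (mk_sumFilt_le h (mk_range_le.trans ?_) (mk_sumFilt_le h
    (mk_range_le.trans ?_) (mk_sumFilt_le h (mk_range_le.trans ?_) (mk_range_le.trans ?_))))
  · exact le_self_add.trans (B.card_eq j).le
  · exact le_add_self.trans (B.card_eq j).le
  · exact ((P.r j).card_eq.trans (B.card_eq j)).le
  · exact ((Q.r j).card_eq.trans (B.card_eq j)).le

theorem mk_typeFilt_le (hW : K.IsScale W) (j : T) : #(typeFilt P Q j) ≤ #(W j) :=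
  mk_sumFilt_le (hW.aleph0_le j) (mk_givenFilt_le P Q hW j)
    (mk_enumFilt_le (hW.aleph0_le j) (hW.mk_Iic_le j))

theorem mk_amalgFilt_le (hW : K.IsScale W) (j : T) : #(amalgFilt P Q j) ≤ #(W j) :=
  mk_sumFilt_le (hW.aleph0_le j)
    (mk_sumFilt_le (hW.aleph0_le j) (mk_typeFilt_le P Q hW j) (mk_typeFilt_le P Q hW j))
    (mk_enumFilt_le (hW.aleph0_le j) (hW.mk_Iic_le j))

end Filt

/-- The labels in `s`, which are labels of elements of `X`, label a strong substructure isomorphic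
to the one of `X`. -/
structure LabelsStrong (K : AEC L) {X N : Type u} [L.Structure X] [L.Structure N] (s : Set X)
    (c : X → N) : Prop where
  same : SameDiag L s id c
  strong : K.StrongSet (c '' s)

/-- At level `j`, the labelled structures `Z` look like a zigzag of amalgams that shows that the
restrictions of `p` and `q` are equal. -/
structure LabelledZigzag.IsZigzagAt (P : Resolution B p) (Q : Resolution B q)
    (Z : LabelledZigzag L (TypeLabel T Ω p q) (AmalgLabel T Ω p q)) (j : T) : Prop where
  strong_type : ∀ k, K.StrongSet (Z.lR k '' typeFilt P Q j)
  strong_amalg : ∀ k, K.StrongSet (Z.lA k '' amalgFilt P Q j)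
  same_left : ∀ k, SameDiag L (typeFilt P Q j) (Z.lR k) fun x => Z.lA k (.inl (.inl x))
  same_right : ∀ k, SameDiag L (typeFilt P Q j) (Z.lR (k + 1)) fun x => Z.lA k (.inl (.inr x))
  strong_left : ∀ k, K.StrongSet (Z.lA k '' ((fun x => .inl (.inl x)) '' typeFilt P Q j))
  strong_right : ∀ k, K.StrongSet (Z.lA k '' ((fun x => .inl (.inr x)) '' typeFilt P Q j))
  agree_emb : ∀ k m, Z.lA k (.inl (.inl (.inl (.inr (.inl (B.e j m)))))) =
    Z.lA k (.inl (.inr (.inl (.inr (.inl (B.e j m))))))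
  agree_a : ∀ k i, Z.lA k (.inl (.inl (.inl (.inr (.inr (.inl (B.s j i))))))) =
    Z.lA k (.inl (.inr (.inl (.inr (.inr (.inl (B.s j i)))))))
  -- The labels from `Ω` keep the limit from being too small: they will name `#Ω` distinct elements
  -- of it.
  injOn : ∀ k, Set.InjOn (fun ω => Z.lR k (.inl (.inl ω))) (W j)
  base : ∀ k, K.LabelsStrong (Set.range (B.e j)) fun m => Z.lR k (.inl (.inr (.inl m)))
  left : K.LabelsStrong (Set.range (P.f j)) fun x => Z.lR 0 (.inl (.inr (.inr (.inr (.inl x)))))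
  left_emb : ∀ m, Z.lR 0 (.inl (.inr (.inr (.inr (.inl (p.emb (B.e j m))))))) =
    Z.lR 0 (.inl (.inr (.inl (B.e j m))))
  left_a : ∀ i, Z.lR 0 (.inl (.inr (.inr (.inr (.inl (p.a (B.s j i))))))) =
    Z.lR 0 (.inl (.inr (.inr (.inl (B.s j i)))))
  right : K.LabelsStrong (Set.range (Q.f j)) fun x =>
    Z.lR Z.n (.inl (.inr (.inr (.inr (.inr x)))))
  right_emb : ∀ m, Z.lR Z.n (.inl (.inr (.inr (.inr (.inr (q.emb (B.e j m))))))) =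
    Z.lR Z.n (.inl (.inr (.inl (B.e j m))))
  right_a : ∀ i, Z.lR Z.n (.inl (.inr (.inr (.inr (.inr (q.a (B.s j i))))))) =
    Z.lR Z.n (.inl (.inr (.inr (.inl (B.s j i)))))

/-- The property `IsZigzagAt P Q · j` depends only on what is labelled by the labels of level `j`. -/
theorem LabelledZigzag.IsZigzagAt.transfer {P : Resolution B p} {Q : Resolution B q}
    {Z Z' : LabelledZigzag L (TypeLabel T Ω p q) (AmalgLabel T Ω p q)} {j : T}
    (h : Z.IsZigzagAt P Q j) (hn : Z'.n = Z.n)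
    (hR : ∀ k, SameDiag L (typeFilt P Q j) (Z.lR k) (Z'.lR k))
    (hA : ∀ k, SameDiag L (amalgFilt P Q j) (Z.lA k) (Z'.lA k))
    (sR : ∀ k, ∀ s ⊆ typeFilt P Q j, K.StrongSet (Z.lR k '' s) → K.StrongSet (Z'.lR k '' s))
    (sA : ∀ k, ∀ s ⊆ amalgFilt P Q j, K.StrongSet (Z.lA k '' s) → K.StrongSet (Z'.lA k '' s)) :
    Z'.IsZigzagAt P Q j := by
  have hlab : ∀ {X : Type u} [L.Structure X] {s : Set X} {k : ℕ} (g : X → TypeLabel T Ω p q),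
      (∀ x ∈ s, g x ∈ typeFilt P Q j) → K.LabelsStrong s (fun x => Z.lR k (g x)) →
      K.LabelsStrong s (fun x => Z'.lR k (g x)) := by
    intro X _ s k g hg hs
    refine ⟨hs.same.trans ((hR k).comp hg), ?_⟩
    have := sR k (g '' s) (by rintro _ ⟨x, hx, rfl⟩; exact hg x hx)
    rw [Set.image_image, Set.image_image] at this
    exact this hs.strong
  have hfp : ∀ m, p.emb (B.e j m) ∈ Set.range (P.f j) := fun m => ⟨_, P.f_emb j m⟩
  have hap : ∀ m, p.a (B.s j m) ∈ Set.range (P.f j) := fun m => ⟨_, P.f_a j m⟩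
  have hfq : ∀ m, q.emb (B.e j m) ∈ Set.range (Q.f j) := fun m => ⟨_, Q.f_emb j m⟩
  have haq : ∀ m, q.a (B.s j m) ∈ Set.range (Q.f j) := fun m => ⟨_, Q.f_a j m⟩
  have hme : ∀ m, B.e j m ∈ Set.range (B.e j) := Set.mem_range_self
  have hms : ∀ i, B.s j i ∈ Set.range (B.s j) := Set.mem_range_self
  exact
  { strong_type := fun k => sR k _ subset_rfl (h.strong_type k)
    strong_amalg := fun k => sA k _ subset_rfl (h.strong_amalg k)
    same_left := fun k => ((hR k).symm.trans (h.same_left k)).trans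
      ((hA k).comp (f := fun x => .inl (.inl x)) fun x hx => hx)
    same_right := fun k => ((hR (k + 1)).symm.trans (h.same_right k)).trans
      ((hA k).comp (f := fun x => .inl (.inr x)) fun x hx => hx)
    strong_left := fun k => sA k _ (by rintro _ ⟨x, hx, rfl⟩; exact hx) (h.strong_left k)
    strong_right := fun k => sA k _ (by rintro _ ⟨x, hx, rfl⟩; exact hx) (h.strong_right k)
    agree_emb := fun k m => ((hA k).eq_iff _ (hme m) _ (hme m)).1 (h.agree_emb k m)
    agree_a := fun k m => ((hA k).eq_iff _ (hms m) _ (hms m)).1 (h.agree_a k m)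
    injOn := fun k x hx y hy hxy => h.injOn k hx hy (((hR k).eq_iff _ hx _ hy).2 hxy)
    base := fun k => hlab (fun m => .inl (.inr (.inl m))) (fun m hm => hm) (h.base k)
    left := hlab (fun x => .inl (.inr (.inr (.inr (.inl x))))) (fun x hx => hx) h.left
    left_emb := fun m => ((hR 0).eq_iff _ (hfp m) _ (hme m)).1 (h.left_emb m)
    left_a := fun m => ((hR 0).eq_iff _ (hap m) _ (hms m)).1 (h.left_a m)
    right := by
      rw [hn]
      exact hlab (fun x => .inl (.inr (.inr (.inr (.inr x))))) (fun x hx => hx) h.right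
    right_emb := fun m => by
      rw [hn]; exact ((hR _).eq_iff _ (hfq m) _ (hme m)).1 (h.right_emb m)
    right_a := fun m => by
      rw [hn]; exact ((hR _).eq_iff _ (haq m) _ (hms m)).1 (h.right_a m) }

end AEC

/-! ### Zigzags up to each level, and the passage to the limit -/

namespace AEC

open FirstOrder.Language

variable {L : FirstOrder.Language.{u, u}} {K : AEC L} {T Ω I M : Type u} [LinearOrder T]
  [L.Structure M] {W : T → Set Ω} {B : Filtration K I M W} {p q : K.Pretype I M}

theorem LabelsStrong.mono {X N : Type u} [L.Structure X] [L.Structure N] {s t : Set X} {c : X → N}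
    (h : SameDiag L t id c ∧ ∀ s ⊆ t, K.StrongSet s → K.StrongSet (c '' s)) (hst : s ⊆ t)
    (hs : K.StrongSet s) : K.LabelsStrong s c :=
  ⟨h.1.mono hst, h.2 s hst hs⟩

theorem Resolution.exists_partial_labelling (P : Resolution B p) (i : T)
    {r : K.Pretype (B.J i) (B.E i)} (h : r = P.r i) (d : r.N) :
    ∃ c : p.N → r.N, (∀ m, c (p.emb (B.e i m)) = r.emb m) ∧ (∀ x, c (p.a (B.s i x)) = r.a x) ∧
      SameDiag L (Set.range (P.f i)) id c ∧
      ∀ s ⊆ Set.range (P.f i), K.StrongSet s → K.StrongSet (c '' s) := by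
  subst h
  obtain ⟨c, hc, h⟩ := AEC.exists_partial_labelling (P.isKEmb i)
    (IsKEmb.refl (K := K) (P.r i).isKEmb.mem_right) d
  refine ⟨c, fun m => ?_, fun x => ?_, h⟩
  · rw [← P.f_emb, hc]; rfl
  · rw [← P.f_a, hc]; rfl

theorem exists_isZigzagAt [WellFoundedLT T] (hW : K.IsScale W) (P : Resolution B p)
    (Q : Resolution B q) (i : T) (h : P.r i ≈ Q.r i) :
    ∃ Z : LabelledZigzag L (TypeLabel T Ω p q) (AmalgLabel T Ω p q),
      ∀ j ≤ i, Z.IsZigzagAt P Q j := by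
  obtain ⟨n, r, h0, hn, hr⟩ := Pretype.exists_zigzag h
  have hcard : ∀ k, #(r k).N = #(W i) := fun k => (r k).card_eq.trans (B.card_eq i)
  have hne : ∀ k, Nonempty (r k).N := fun k => by
    rw [← mk_ne_zero_iff, hcard]
    exact (aleph0_pos.trans_le (hW.aleph0_le i)).ne'
  have d : ∀ k, (r k).N := fun k => (hne k).some
  have hcΩ : ∀ k, ∃ c : Ω → (r k).N, Set.InjOn c (W i) := fun k => by
    obtain ⟨g⟩ := Cardinal.le_def _ _ |>.1 (hcard k).ge
    refine ⟨Function.extend Subtype.val g fun _ => d k, fun x hx y hy hxy => ?_⟩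
    have he : ∀ x : W i, Function.extend Subtype.val g (fun _ => d k) x = g x :=
      Subtype.val_injective.extend_apply g _
    have := (he ⟨x, hx⟩).symm.trans (hxy.trans (he ⟨y, hy⟩))
    exact congrArg Subtype.val (g.injective this)
  have hcI : ∀ k, ∃ c : I → (r k).N, ∀ x, c (B.s i x) = (r k).a x := fun k =>
    ⟨Function.extend (B.s i) (r k).a fun _ => d k, (B.s i).injective.extend_apply _ _⟩
  -- All structures share one label set, so labels from `p.N` need values in every `(r k).N`. They
  -- carry meaning only at the left end `k = 0`, as do those from `q.N` at the right end `k = n`.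
  have hcP : ∀ k, ∃ c : p.N → (r k).N, k = 0 →
      (∀ m, c (p.emb (B.e i m)) = (r k).emb m) ∧ (∀ x, c (p.a (B.s i x)) = (r k).a x) ∧
      SameDiag L (Set.range (P.f i)) id c ∧
      ∀ s ⊆ Set.range (P.f i), K.StrongSet s → K.StrongSet (c '' s) := fun k => by
    by_cases hk : k = 0
    · subst hk
      obtain ⟨c, hc⟩ := P.exists_partial_labelling i h0 (d 0)
      exact ⟨c, fun _ => hc⟩
    · exact ⟨fun _ => d k, fun h => absurd h hk⟩
  have hcQ : ∀ k, ∃ c : q.N → (r k).N, k = n →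
      (∀ m, c (q.emb (B.e i m)) = (r k).emb m) ∧ (∀ x, c (q.a (B.s i x)) = (r k).a x) ∧
      SameDiag L (Set.range (Q.f i)) id c ∧
      ∀ s ⊆ Set.range (Q.f i), K.StrongSet s → K.StrongSet (c '' s) := fun k => by
    by_cases hk : k = n
    · subst hk
      obtain ⟨c, hc⟩ := Q.exists_partial_labelling i hn (d k)
      exact ⟨c, fun _ => hc⟩
    · exact ⟨fun _ => d k, fun h => absurd h hk⟩
  choose cΩ hcΩ using hcΩ
  choose cM hcM hcM' using fun k => AEC.exists_partial_labelling (B.isKEmb i) (r k).isKEmb (d k)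
  choose cI hcI using hcI
  choose cP hcP using hcP
  choose cQ hcQ using hcQ
  choose lR hlR hlR' using fun k => exists_labelling hW (r k).isKEmb.mem_right (mk_givenFilt_le P Q hW)
    (Sum.elim (cΩ k) (Sum.elim (cM k) (Sum.elim (cI k) (Sum.elim (cP k) (cQ k)))))
  choose A strA f g hf hg hfg hfga using hr
  choose lA hlA hlA' using fun k =>
    have : Nonempty (A k) := (hne k).map (f k)
    exists_labelling hW (hf k).mem_right
    (fun j => mk_sumFilt_le (hW.aleph0_le j) (mk_typeFilt_le P Q hW j) (mk_typeFilt_le P Q hW j))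
    (Sum.elim (f k ∘ lR k) (g k ∘ lR (k + 1)))
  refine ⟨⟨n, fun k => (r k).N, A, lR, lA⟩, fun j hj => ?_⟩
  -- The values were chosen at level `i`; monotonicity of the filtrations makes them correct at each
  -- level `j ≤ i`.
  have hE := B.monotone_e hj
  have hS := B.monotone_s hj
  have strong_range : ∀ {X Y : Type u} [L.Structure X] [L.Structure Y] {f : X ↪[L] Y},
    K.IsKEmb f → K.StrongSet (Set.range f) := fun h => isKEmb_iff.1 h
  refine
  { strong_type := fun k => hlR' k j
    strong_amalg := fun k => hlA' k j
    same_left := fun k => .of_embedding (f k) fun x _ => hlA k (.inl x)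
    same_right := fun k => .of_embedding (g k) fun x _ => hlA k (.inr x)
    strong_left := fun k => ?_
    strong_right := fun k => ?_
    agree_emb := fun k m => ?_
    agree_a := fun k x => ?_
    injOn := fun k x hx y hy hxy => hcΩ k (hW.mono hj hx) (hW.mono hj hy) ?_
    base := fun k => ?_
    left := ?_
    left_emb := ?_
    left_a := ?_
    right := ?_
    right_emb := ?_
    right_a := ?_ }
  · have := (hlR' k j).image (hf k)
    rw [Set.image_image] at this ⊢
    simp only [hlA]
    exact this
  · have := (hlR' (k + 1) j).image (hg k)
    rw [Set.image_image] at this ⊢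
    simp only [hlA]
    exact this
  · obtain ⟨m', hm'⟩ := hE ⟨m, rfl⟩
    simp only [hlA, hlR, Sum.elim_inl, Sum.elim_inr, Function.comp_apply]
    rw [← hm', hcM, hcM, hfg]
  · obtain ⟨x', hx'⟩ := hS ⟨x, rfl⟩
    simp only [hlA, hlR, Sum.elim_inl, Sum.elim_inr, Function.comp_apply]
    rw [← hx', hcI, hcI, hfga]
  · simpa only [hlR, Sum.elim_inl] using hxy
  · simp only [hlR]
    exact LabelsStrong.mono (hcM' k) hE (strong_range (B.isKEmb j))
  · simp only [hlR]
    exact LabelsStrong.mono (hcP 0 rfl).2.2 (P.monotone_f hj) (strong_range (P.isKEmb j))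
  · intro m
    obtain ⟨m', hm'⟩ := hE ⟨m, rfl⟩
    simp only [hlR, Sum.elim_inl, Sum.elim_inr]
    rw [← hm', (hcP 0 rfl).1, hcM]
  · intro x
    obtain ⟨x', hx'⟩ := hS ⟨x, rfl⟩
    simp only [hlR, Sum.elim_inl, Sum.elim_inr]
    rw [← hx', (hcP 0 rfl).2.1, hcI]
  · simp only [hlR]
    exact LabelsStrong.mono (hcQ n rfl).2.2 (Q.monotone_f hj) (strong_range (Q.isKEmb j))
  · intro m
    obtain ⟨m', hm'⟩ := hE ⟨m, rfl⟩
    simp only [hlR, Sum.elim_inl, Sum.elim_inr]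
    rw [← hm', (hcQ n rfl).1, hcM]
  · intro x
    obtain ⟨x', hx'⟩ := hS ⟨x, rfl⟩
    simp only [hlR, Sum.elim_inl, Sum.elim_inr]
    rw [← hx', (hcQ n rfl).2.1, hcI]

/-- This bounds the number of kinds at a level, by `L.card ≤ K.LS` and the strong limit property.
The natural number in a pair says which structure of the zigzag the formula is evaluated in. -/
theorem mk_formula_lt [WellFoundedLT T] (hT : HasBranchProperty T) (hLS : K.LS < #T) {α : Type u}
    (hα : #α < #T) : #(Set (ℕ × L.Formula α)) < #T := by
  have hω : ℵ₀ < #T := (aleph0_le_LS K).trans_lt hLS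
  have hL : L.card < #T := (le_self_add.trans K.hasLSProperty_LS.1).trans_lt hLS
  have h1 : #(L.Formula α) < #T := by
    have : #(L.Formula α) ≤ #(Σ n, L.BoundedFormula α n) :=
      mk_le_of_injective (f := fun φ => ⟨0, φ⟩) (by intro a b h; simpa using h)
    refine (this.trans BoundedFormula.card_le).trans_lt (max_lt hω ?_)
    simpa using add_lt_of_lt hω.le hα hL
  refine hT.mk_set_lt ?_
  rw [mk_prod, lift_uzero, mk_nat, lift_aleph0]
  exact mul_lt_of_lt hω.le hω h1

/-- If `p` and `q` have zigzags up to each level, then they have a zigzag for all levels. -/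
theorem exists_limit_zigzag [WellFoundedLT T] (hT : HasBranchProperty T) (hLS : K.LS < #T)
    (hW : K.IsScale W) (P : Resolution B p) (Q : Resolution B q)
    (h : ∀ i, ∃ Z : LabelledZigzag L (TypeLabel T Ω p q) (AmalgLabel T Ω p q),
      ∀ j ≤ i, Z.IsZigzagAt P Q j) :
    ∃ Z : LabelledZigzag L (TypeLabel T Ω p q) (AmalgLabel T Ω p q),
      (∀ j, Z.IsZigzagAt P Q j) ∧ (∀ k, Function.Surjective (Z.lR k)) := by
  have hω : ℵ₀ < #T := (aleph0_le_LS K).trans_lt hLS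
  have := hT.nonempty
  choose Z hZ using h
  -- Strongness need not be part of the kind: `IsZigzagAt` provides it for stage `i` at every level
  -- `j ≤ i`.
  let Y : T → Type u := fun j => ULift.{u} ℕ × Set (ℕ × L.Formula (typeFilt P Q j)) ×
    Set (ℕ × L.Formula (amalgFilt P Q j))
  have hY : ∀ j, #(Y j) < #T := fun j => by
    have h1 := mk_formula_lt hT hLS ((mk_typeFilt_le P Q hW j).trans_lt (hW.mk_lt j))
    have h2 := mk_formula_lt hT hLS ((mk_amalgFilt_le P Q hW j).trans_lt (hW.mk_lt j))
    simp only [Y, mk_prod, lift_id]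
    exact mul_lt_of_lt hω.le (by simpa) (mul_lt_of_lt hω.le h1 h2)
  let c : ∀ j, T → Y j := fun j i => (⟨(Z i).n⟩,
    {x | x.2.Realize fun y => (Z i).lR x.1 y}, {x | x.2.Realize fun y => (Z i).lA x.1 y})
  obtain ⟨σ, hσ, hc⟩ := hT.exists_coherent_choice hY c
  have hn : ∀ i j, i ≤ j → (Z (σ j)).n = (Z (σ i)).n := fun i j hij =>
    congrArg ULift.down (congrArg Prod.fst (hc i j hij))
  have hR : ∀ k i j, i ≤ j → SameDiag L (typeFilt P Q i) ((Z (σ i)).lR k) ((Z (σ j)).lR k) :=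
    fun k i j hij => .of_realize_formula fun φ =>
      (Set.ext_iff.1 (congrArg (fun y : Y i => y.2.1) (hc i j hij)) (k, φ)).symm
  have hA : ∀ k i j, i ≤ j → SameDiag L (amalgFilt P Q i) ((Z (σ i)).lA k) ((Z (σ j)).lA k) :=
    fun k i j hij => .of_realize_formula fun φ =>
      (Set.ext_iff.1 (congrArg (fun y : Y i => y.2.2) (hc i j hij)) (k, φ)).symm
  have hZσ : ∀ i j, i ≤ j → (Z (σ j)).IsZigzagAt P Q i := fun i j hij =>
    hZ (σ j) i (hij.trans (hσ j))
  -- Each position `k` of the zigzag has its own direct limit. `transfer` then carries the relations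
  -- between positions over, as they concern only labels of bounded level.
  choose R strR lR hsurj hRs hRt using fun k => exists_limit (monotone_typeFilt P Q hW.mono)
    (cover_typeFilt P Q hW) (fun j => (Z (σ j)).R k) (fun j => (Z (σ j)).lR k)
    (fun i j hij => (hZσ i j hij).strong_type k) (hR k)
  choose A strA lA _ hAs hAt using fun k => exists_limit (monotone_amalgFilt P Q hW.mono)
    (cover_amalgFilt P Q hW) (fun j => (Z (σ j)).A k) (fun j => (Z (σ j)).lA k)
    (fun i j hij => (hZσ i j hij).strong_amalg k) (hA k)
  obtain ⟨j₀⟩ := hT.nonempty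
  refine ⟨⟨(Z (σ j₀)).n, R, A, lR, lA⟩, fun j => (hZσ j j le_rfl).transfer ?_ (fun k => hRs k j)
    (fun k => hAs k j) (fun k => hRt k j) (fun k => hAt k j), hsurj⟩
  rcases le_total j j₀ with h | h
  · exact hn _ _ h
  · exact (hn _ _ h).symm

/-- The labels from `M` embed `M` into each `Z.R k`, making it a pretype. It has the right size: at
most by surjectivity of the labelling, at least by the labels from `Ω`. The labels from `p.N` and
`q.N` embed these models into the two ends of the zigzag, which therefore serve as amalgams
themselves. -/
theorem equiv_of_isZigzagAt [WellFoundedLT T] [Nonempty T] (hT : ℵ₀ ≤ #T) (hW : K.IsScale W)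
    (hΩ : #Ω = #T) (hIM : #M + #I = #T) (P : Resolution B p) (Q : Resolution B q)
    (Z : LabelledZigzag L (TypeLabel T Ω p q) (AmalgLabel T Ω p q))
    (h : ∀ j, Z.IsZigzagAt P Q j) (hsurj : ∀ k, Function.Surjective (Z.lR k)) : p ≈ q := by
  have hcard : ∀ k, #(Z.R k) = #M + #I := by
    intro k
    rw [hIM]
    apply le_antisymm
    · have hM : #M ≤ #T := le_self_add.trans hIM.le
      have hI : #I ≤ #T := le_add_self.trans hIM.le
      have hp : #p.N ≤ #T := (p.card_eq.trans hIM).le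
      have hq : #q.N ≤ #T := (q.card_eq.trans hIM).le
      refine (mk_le_of_surjective (hsurj k)).trans ?_
      simp only [mk_sum, mk_prod, lift_id]
      refine add_le_of_le hT (add_le_of_le hT hΩ.le (add_le_of_le hT hM (add_le_of_le hT hI
        (add_le_of_le hT hp hq)))) ?_
      rw [hΩ, mul_eq_self hT]
    · rw [← hΩ]
      refine mk_le_of_injective (f := fun ω => Z.lR k (.inl (.inl ω))) fun x y hxy => ?_
      obtain ⟨i, hi⟩ := hW.cover x
      obtain ⟨j, hj⟩ := hW.cover y
      exact (h (max i j)).injOn k (hW.mono (le_max_left _ _) hi) (hW.mono (le_max_right _ _) hj) hxy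
  choose e he hel using fun k => exists_isKEmb B.monotone_e B.cover_e (l := id)
    Function.surjective_id (fun j => ((h j).base k).same) fun j => ((h j).base k).strong
  let r : ℕ → K.Pretype I M := fun k =>
    { N := Z.R k
      emb := e k
      isKEmb := he k
      card_eq := hcard k
      a := fun x => Z.lR k (.inl (.inr (.inr (.inl x)))) }
  have hr : ∀ k, (r k).AT (r (k + 1)) := by
    intro k
    obtain ⟨f, hf, hfl⟩ := exists_isKEmb (monotone_typeFilt P Q hW.mono) (cover_typeFilt P Q hW)
      (hsurj k) (fun j => (h j).same_left k) fun j => by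
        have := (h j).strong_left k
        rwa [Set.image_image] at this
    obtain ⟨g, hg, hgl⟩ := exists_isKEmb (monotone_typeFilt P Q hW.mono) (cover_typeFilt P Q hW)
      (hsurj (k + 1)) (fun j => (h j).same_right k) fun j => by
        have := (h j).strong_right k
        rwa [Set.image_image] at this
    refine ⟨Z.A k, _, f, g, hf, hg, fun m => ?_, fun x => ?_⟩
    · obtain ⟨j, m, rfl⟩ := B.cover_e m
      refine ((congrArg f (hel k _)).trans (hfl _)).trans (((h j).agree_emb k m).trans ?_)
      exact ((congrArg g (hel (k + 1) _)).trans (hgl _)).symm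
    · obtain ⟨j, x, rfl⟩ := B.cover_s x
      exact (hfl _).trans (((h j).agree_a k x).trans (hgl _).symm)
  have hp : p.AT (r 0) := by
    obtain ⟨f, hf, hfl⟩ := exists_isKEmb P.monotone_f P.cover_f (l := id)
      Function.surjective_id (fun j => (h j).left.same) fun j => (h j).left.strong
    refine ⟨Z.R 0, _, f, .refl L _, hf, .refl hf.mem_right, fun m => ?_, fun x => ?_⟩
    · obtain ⟨j, m, rfl⟩ := B.cover_e m
      exact (hfl _).trans (((h j).left_emb m).trans (hel 0 _).symm)
    · obtain ⟨j, x, rfl⟩ := B.cover_s x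
      exact (hfl _).trans ((h j).left_a x)
  have hq : q.AT (r Z.n) := by
    obtain ⟨f, hf, hfl⟩ := exists_isKEmb Q.monotone_f Q.cover_f (l := id)
      Function.surjective_id (fun j => (h j).right.same) fun j => (h j).right.strong
    refine ⟨Z.R Z.n, _, f, .refl L _, hf, .refl hf.mem_right, fun m => ?_, fun x => ?_⟩
    · obtain ⟨j, m, rfl⟩ := B.cover_e m
      exact (hfl _).trans (((h j).right_emb m).trans (hel _ _).symm)
    · obtain ⟨j, x, rfl⟩ := B.cover_s x
      exact (hfl _).trans ((h j).right_a x)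
  exact Setoid.trans (.single hp) (Setoid.trans (Pretype.equiv_of_zigzag hr Z.n) (.single hq.symm))

end AEC

/-! ### From agreement along a filtration to tameness and type shortness -/

namespace AEC

open FirstOrder.Language

variable {L : FirstOrder.Language.{u, u}} {K : AEC L}

section Resolution

variable {T Ω I M : Type u} [LinearOrder T] [L.Structure M] {W : T → Set Ω}

theorem exists_resolution [WellFoundedLT T] (hW : K.IsScale W) (B : Filtration K I M W) (p : K.Pretype I M)
    (hp : #Ω = #p.N) : Nonempty (Resolution B p) := by
  -- Placing the copy of `W j` inside the `j`-th submodel makes the submodels cover `p.N` and have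
  -- exactly the size `#(W j)`.
  obtain ⟨eqv⟩ := Cardinal.eq.1 hp
  obtain ⟨P, hPm, hP⟩ := exists_monotone_strong p.isKEmb.mem_right hW.mono hW.LS_le
    (fun j => (mk_le_mk_of_subset Set.Iio_subset_Iic_self).trans (hW.mk_Iic_le j))
    (X := fun j => Set.range (p.emb ∘ B.e j) ∪ Set.range (p.a ∘ B.s j) ∪ eqv '' W j) fun j =>
      (mk_union_le _ _).trans (add_le_of_le (hW.aleph0_le j) ((mk_union_le _ _).trans
        (add_le_of_le (hW.aleph0_le j)
          (mk_range_le.trans (le_self_add.trans (B.card_eq j).le))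
          (mk_range_le.trans (le_add_self.trans (B.card_eq j).le)))) mk_image_le)
  have h1 : ∀ j m, (p.emb.comp (B.e j)) m ∈ P j := fun j m =>
    (hP j).2.1 (.inl (.inl ⟨m, rfl⟩))
  have h2 : ∀ j i, p.a (B.s j i) ∈ P j := fun j i => (hP j).2.1 (.inl (.inr ⟨i, rfl⟩))
  have h3 : ∀ j, eqv '' W j ⊆ P j := fun j => Set.subset_union_right.trans (hP j).2.1
  have hrange : ∀ j, Set.range (P j).subtype = P j := fun j => Subtype.range_coe
  exact ⟨{
    r := fun j =>
      { N := P j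
        emb := (p.emb.comp (B.e j)).codRestrict (P j) (h1 j)
        isKEmb := (p.isKEmb.comp (B.isKEmb j)).codRestrict (hP j).1 (h1 j)
        card_eq := by
          rw [B.card_eq]
          refine (hP j).2.2.antisymm ?_
          rw [← mk_image_eq (s := W j) eqv.injective]
          exact mk_le_mk_of_subset (h3 j)
        a := fun i => ⟨_, h2 j i⟩ }
    f := fun j => (P j).subtype
    isKEmb := fun j => isKEmb_subtype (hP j).1
    f_emb := fun _ _ => rfl
    f_a := fun _ _ => rfl
    monotone_f := fun i j hij => by simpa only [hrange, SetLike.coe_subset_coe] using hPm hij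
    cover_f := fun x => by
      obtain ⟨j, hj⟩ := hW.cover (eqv.symm x)
      exact ⟨j, by rw [hrange]; exact h3 j ⟨_, hj, by simp⟩⟩ }⟩

theorem Resolution.isRestriction {B : Filtration K I M W} {p : K.Pretype I M}
    (P : Resolution B p) (j : T) : Pretype.IsRestriction (B.e j) (B.s j) p (P.r j) :=
  ⟨P.f j, P.isKEmb j, P.f_emb j, P.f_a j⟩

/-- `reduct` is defined through an arbitrary choice of restriction; this replaces the chosen ones by
the members of given resolutions. -/
theorem GaloisType.equiv_of_reduct_eq [K.NoSmallModels] {J M' : Type u} [L.Structure M']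
    {e : M' ↪[L] M} {he : K.IsKEmb e} {s : J ↪ I} {p q : K.Pretype I M}
    (h : GaloisType.reduct e he s ⟦p⟧ = GaloisType.reduct e he s ⟦q⟧) {r t : K.Pretype J M'}
    (hr : Pretype.IsRestriction e s p r) (ht : Pretype.IsRestriction e s q t) : r ≈ t := by
  have hp := (Pretype.exists_isRestriction he s p).choose_spec
  have hq := (Pretype.exists_isRestriction he s q).choose_spec
  exact Setoid.trans (Pretype.equiv_of_isRestriction he (Setoid.refl p) hr hp)
    (Setoid.trans (Quotient.exact h) (Pretype.equiv_of_isRestriction he (Setoid.refl q) hq ht))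

/-- Galois types over `M` with the same restrictions to the members of a filtration are equal. -/
theorem GaloisType.eq_of_reduct_eq [WellFoundedLT T] [K.NoSmallModels] (hT : HasBranchProperty T)
    (hLS : K.LS < #T) (hW : K.IsScale W) (hΩ : #Ω = #T) (hIM : #M + #I = #T)
    (B : Filtration K I M W) {p q : K.GaloisType I M}
    (h : ∀ j, p.reduct (B.e j) (B.isKEmb j) (B.s j) = q.reduct (B.e j) (B.isKEmb j) (B.s j)) :
    p = q := by
  induction p using Quotient.inductionOn with | _ p
  induction q using Quotient.inductionOn with | _ q
  have := hT.nonempty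
  obtain ⟨P⟩ := exists_resolution hW B p (by rw [p.card_eq, hIM, hΩ])
  obtain ⟨Q⟩ := exists_resolution hW B q (by rw [q.card_eq, hIM, hΩ])
  obtain ⟨Z, hZ, hsurj⟩ := exists_limit_zigzag hT hLS hW P Q fun i =>
    exists_isZigzagAt hW P Q i
      (GaloisType.equiv_of_reduct_eq (h i) (P.isRestriction i) (Q.isRestriction i))
  exact Quotient.sound (equiv_of_isZigzagAt hT.aleph0_le hW hΩ hIM P Q Z hZ hsurj)

end Resolution

section Scale

variable {T V : Type u} [LinearOrder T]

/-- The initial segments of `T`, together with all of `V`. -/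
def scale (T V : Type u) [LinearOrder T] : T → Set (T ⊕ V) :=
  sumFilt Set.Iic fun _ => Set.univ

theorem mk_scale (j : T) : #(scale T V j) = #(Set.Iic j) + #V := by
  have : scale T V j = Sum.inl '' Set.Iic j ∪ Set.range Sum.inr := by
    ext (x | x) <;> simp [scale, sumFilt]
  rw [this, mk_union_of_disjoint, mk_image_eq Sum.inl_injective, mk_range_eq _ Sum.inr_injective]
  rw [Set.disjoint_left]
  rintro _ ⟨x, -, rfl⟩ ⟨y, hy⟩
  cases hy

theorem isScale_scale [WellFoundedLT T] (hT : HasBranchProperty T) (hV : #V < #T) (hLS : K.LS ≤ #V) :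
    K.IsScale (scale T V) where
  mono := monotone_sumFilt (fun _ _ h => Set.Iic_subset_Iic.2 h) monotone_const
  LS_le j := hLS.trans (by rw [mk_scale]; exact le_add_self)
  mk_Iic_le j := by rw [mk_scale]; exact le_self_add
  mk_lt j := by
    rw [mk_scale]
    exact add_lt_of_lt hT.aleph0_le (hT.mk_Iic_lt j) hV
  cover := cover_sumFilt (fun x => ⟨x, le_rfl⟩) fun _ => ⟨hT.nonempty.some, trivial⟩

theorem le_mk_scale (j : T) : #V ≤ #(scale T V j) := by
  rw [mk_scale]; exact le_add_self

theorem mk_sum_eq [WellFoundedLT T] (hT : HasBranchProperty T) (hV : #V < #T) : #(T ⊕ V) = #T := by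
  rw [mk_sum, lift_id, lift_id, add_eq_left hT.aleph0_le hV.le]

end Scale

variable {T : Type u} [LinearOrder T] [WellFoundedLT T] [K.NoSmallModels]

theorem isTameLT_of_hasBranchProperty (hT : HasBranchProperty T) (hLS : K.LS < #T) {I : Type u}
    (hI : #I < #T) : K.IsTameLT #T #T I := by
  intro M _ hM hMT p q hpq
  by_contra! hcon
  -- Every level contains `V`, so it has size at least `K.LS`, and adding `I` to it does not change
  -- its size.
  let V : Type u := K.LS.out ⊕ I
  have hV : #V < #T := by
    simpa [V] using add_lt_of_lt hT.aleph0_le hLS hI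
  have hLSV : K.LS ≤ #V := by simp [V]
  have hIV : #I ≤ #V := by simp [V]
  have hW : K.IsScale (scale T V) := isScale_scale hT hV hLSV
  have hΩ := mk_sum_eq hT hV
  obtain ⟨eqv⟩ := Cardinal.eq.1 (hΩ.trans hMT.symm)
  obtain ⟨P, hPm, hP⟩ := exists_monotone_strong hM hW.mono hW.LS_le
    (fun j => (mk_le_mk_of_subset Set.Iio_subset_Iic_self).trans (hW.mk_Iic_le j))
    (X := fun j => eqv '' scale T V j) fun j => mk_image_le
  have hcard : ∀ j, #(P j) = #(scale T V j) := fun j => (hP j).2.2.antisymm (by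
    rw [← mk_image_eq (s := scale T V j) eqv.injective]
    exact mk_le_mk_of_subset (hP j).2.1)
  have hrange : ∀ j, Set.range (P j).subtype = P j := fun j => Subtype.range_coe
  let B : Filtration K I M (scale T V) :=
    { E := fun j => P j
      e := fun j => (P j).subtype
      isKEmb := fun j => isKEmb_subtype (hP j).1
      monotone_e := fun i j hij => by simpa only [hrange, SetLike.coe_subset_coe] using hPm hij
      cover_e := fun x => by
        obtain ⟨j, hj⟩ := hW.cover (eqv.symm x)
        exact ⟨j, by rw [hrange]; exact (hP j).2.1 ⟨_, hj, by simp⟩⟩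
      J := fun _ => I
      s := fun _ => Function.Embedding.refl I
      monotone_s := monotone_const
      cover_s := fun x => ⟨hT.nonempty.some, x, rfl⟩
      card_eq := fun j => by
        rw [hcard, add_eq_left (hW.aleph0_le j) (hIV.trans (le_mk_scale j))] }
  refine hpq (GaloisType.eq_of_reduct_eq hT hLS hW hΩ ?_ B fun j => ?_)
  · rw [hMT, add_eq_left hT.aleph0_le hI.le]
  · exact hcon (P j) (hP j).1 ((hcard j).trans_lt (hW.mk_lt j))

theorem isTypeShortLT_of_hasBranchProperty (hT : HasBranchProperty T) (hLS : K.LS < #T)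
    {μ : Cardinal.{u}} (hμ : μ < #T) : K.IsTypeShortLT #T #T μ := by
  intro M _ hM hMμ I hI p q hpq
  by_contra! hcon
  subst hMμ
  -- Here `M` itself is the constant part of the levels; it is large enough because `K` has no
  -- models smaller than `K.LS`.
  have hW : K.IsScale (scale T M) := isScale_scale hT hμ (NoSmallModels.LS_le M hM)
  have hΩ := mk_sum_eq hT hμ
  obtain ⟨eqv⟩ := Cardinal.eq.1 (hΩ.trans hI.symm)
  have hcard : ∀ j, #(eqv '' scale T M j) = #(scale T M j) := fun j => mk_image_eq eqv.injective
  have hrange : ∀ j, Set.range (Function.Embedding.subtype (· ∈ eqv '' scale T M j)) =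
      eqv '' scale T M j := fun j => Subtype.range_coe
  let B : Filtration K I M (scale T M) :=
    { E := fun _ => M
      str := fun _ => inferInstance
      e := fun _ => Embedding.refl L M
      isKEmb := fun _ => .refl hM
      monotone_e := monotone_const
      cover_e := fun x => ⟨hT.nonempty.some, x, rfl⟩
      J := fun j => eqv '' scale T M j
      s := fun j => Function.Embedding.subtype (· ∈ eqv '' scale T M j)
      monotone_s := fun i j hij => by
        simpa only [hrange] using Set.image_mono (hW.mono hij)
      cover_s := fun x => by
        obtain ⟨j, hj⟩ := hW.cover (eqv.symm x)
        exact ⟨j, by rw [hrange]; exact ⟨_, hj, by simp⟩⟩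
      card_eq := fun j => by
        rw [hcard, add_eq_right (hW.aleph0_le j) (le_mk_scale j)] }
  refine hpq (GaloisType.eq_of_reduct_eq hT hLS hW hΩ ?_ B fun j => ?_)
  · rw [hI, add_eq_right hT.aleph0_le hμ.le]
  · exact hcon (eqv '' scale T M j) ((hcard j).trans_lt (hW.mk_lt j))

end AEC

theorem mainTheorem9 {L : FirstOrder.Language.{u, u}} (K : AEC L) [K.NoSmallModels]
    (κ : Cardinal.{u}) (hκ : IsPi11Indescribable κ) (hLS : K.LS < κ) (hAP : K.Amalgamation κ) :
    (∀ I : Type u, #I < κ → K.IsTameLT κ κ I) ∧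
    (∀ μ : Cardinal.{u}, μ < κ → K.IsTypeShortLT κ κ μ) := by
  have hT := hκ.hasBranchProperty ((AEC.aleph0_le_LS K).trans hLS.le)
  have hmk : #κ.ord.ToType = κ := mk_ord_toType κ
  refine ⟨fun I hI => ?_, fun μ hμ => ?_⟩
  · have := AEC.isTameLT_of_hasBranchProperty (K := K) hT (by rwa [hmk]) (I := I) (by rwa [hmk])
    rwa [hmk] at this
  · have := AEC.isTypeShortLT_of_hasBranchProperty (K := K) hT (by rwa [hmk]) (μ := μ)
      (by rwa [hmk])
    rwa [hmk] at this
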